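/- **Conventions.** Let $\Gamma$ be a countable group acting by Borel automorphisms and measure preservingly on a standard probability space $(X,\mu)$, and let $\Gamma$ act diagonally on $X\times X$. Let $p^i:X\times X\to X$ be the projection $p^i(x_1,x_2)=x_i$, for $i\in\{1,2\}$. For a measurable space $Z$ denote by $\mathcal M(Z)$ the set of probability measures on $Z$, by $B(Z)$ the algebra of bounded measurable functions $Z\to\mathbb C$, and for $\sigma,\sigma'\in\mathcal M(Z)$ let $\|\sigma-\sigma'\|=\sup\{|\int f\,d\sigma-\int f\,d\sigma'| : f\in B(Z),\ \|f\|_\infty\le 1\}$. The crossed product $M=L^\infty(X,\mu)\rtimes\Gamma$ is the von Neumann algebra on $L^2(X,\mu)\otimes\ell^2(\Gamma)=L^2(\Gamma\times X)$ generated by the operators $(f\xi)(h,x)=f(x)\xi(h,x)$, $f\in L^\infty(X,\mu)$, and the unitaries $(u_g\xi)(h,x)=\xi(g^{-1}h,g^{-1}x)$, $g\in\Gamma$; its trace is $\tau(x)=\langle x(1\otimes\delta_e),1\otimes\delta_e\rangle$. A Hilbert $M$-bimodule is a Hilbert space with commuting left and right Hilbert $M$-module structures (normal unital $*$-representations of $M$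 and of the opposite algebra $M^{op}$). A vector $\xi$ in it is tracial if $\langle x\xi,\xi\rangle=\langle\xi x,\xi\rangle=\tau(x)$ for all $x\in M$, and, for a von Neumann subalgebra $B\subset M$, it is $B$-central if $b\xi=\xi b$ for all $b\in B$. The inclusion $B\subset M$ is rigid if for every $\varepsilon>0$ there are a finite set $F\subset M$ and $\delta>0$ such that, whenever $\mathcal H$ is a Hilbert $M$-bimodule and $\xi\in\mathcal H$ is a tracial unit vector with $\|x\xi-\xi x\|\le\delta$ for all $x\in F$, there is a $B$-central vector $\eta\in\mathcal H$ with $\|\eta-\xi\|\le\varepsilon$. **Proposition 2.4.** Let $(Y,\nu)$ be another probability space together with a measurable, measure preserving onto map $q:X\to Y$. View $L^\infty(Y,\nu)$ as a von Neumann subalgebra of $L^\infty(X,\mu)$, and hence of $M$, via the embedding $L^\infty(Y,\nu)\ni f\mapsto f\circ q\in L^\infty(X,\mu)$. Assume that for any sequence of measures $\{\nu_n\}_{n\ge1}\subset\mathcal M(X\times X)$ such that $p^i_*(\nu_n)=\mu$ for all $i\in\{1,2\}$ and $n\ge 1$, (i) $\lim_{n\to\infty}\int_{X\times X}f_1(x)f_2(y)\,d\nu_n(x,y)=\int_X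 f_1f_2\,d\mu$ for all $f_1,f_2\in B(X)$, and (ii) $\lim_{n\to\infty}\|\gamma_*\nu_n-\nu_n\|=0$ for all $\gamma\in\Gamma$, we have $\lim_{n\to\infty}\nu_n(\{(x,y)\in X\times X : q(x)=q(y)\})=1$ (with $\nu_n$ read as outer measure if this set is not measurable). Then the inclusion of von Neumann algebras $L^\infty(Y,\nu)\subset L^\infty(X,\mu)\rtimes\Gamma$ is rigid. -/

import Mathlib

open MeasureTheory Filter Topology
open scoped ENNReal

noncomputable section

namespace RigidInclusion

/-! ### Von Neumann algebras generated by sets of operators -/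

section Generated

variable {H : Type*} [NormedAddCommGroup H] [InnerProductSpace ℂ H] [CompleteSpace H]

/-- The von Neumann algebra generated by a set `S` of bounded operators on a Hilbert space:
the double commutant of `S ∪ S*`. -/
def generatedBy (S : Set (H →L[ℂ] H)) : VonNeumannAlgebra H where
  toStarSubalgebra :=
    StarSubalgebra.centralizer ℂ (StarSubalgebra.centralizer ℂ S : Set (H →L[ℂ] H))
  centralizer_centralizer' := by
    simp only [StarSubalgebra.centralizer]
    simp

end Generated

/-! ### Hilbert bimodules and rigid inclusions -/

section Rigid

variable {H : Type*} [NormedAddCommGroup H] [InnerProductSpace ℂ H] [CompleteSpace H]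

/-- A map from a von Neumann algebra to the bounded operators of a Hilbert space is normal if it
preserves suprema of increasing nets of self-adjoint elements, for the usual order of
operators. -/
def IsNormalMap (M : VonNeumannAlgebra H) {K : Type*} [NormedAddCommGroup K]
    [InnerProductSpace ℂ K] [CompleteSpace K]
    (φ : M.toStarSubalgebra → (K →L[ℂ] K)) : Prop :=
  ∀ (D : Set M.toStarSubalgebra) (s : M.toStarSubalgebra), D.Nonempty →
    (∀ d ∈ D, IsSelfAdjoint (d : H →L[ℂ] H)) →
    (∀ a ∈ D, ∀ b ∈ D, ∃ c ∈ D, (a : H →L[ℂ] H) ≤ c ∧ (b : H →L[ℂ] H) ≤ c) →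
    IsLUB ((fun a : M.toStarSubalgebra => (a : H →L[ℂ] H)) '' D) s → IsLUB (φ '' D) (φ s)

/-- A Hilbert bimodule over the von Neumann algebra `M`: a Hilbert space with commuting left and
right Hilbert `M`-module structures, that is, a normal unital `*`-representation of `M` and a
normal unital `*`-representation of the opposite algebra that commute with each other. -/
structure HilbertBimodule (M : VonNeumannAlgebra H) (K : Type*) [NormedAddCommGroup K]
    [InnerProductSpace ℂ K] [CompleteSpace K] where
  /-- the left action, `x ξ = left x ξ` -/
  left : M.toStarSubalgebra →⋆ₐ[ℂ] (K →L[ℂ] K)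
  /-- the right action, `ξ x = right (op x) ξ` -/
  right : M.toStarSubalgebraᵐᵒᵖ →⋆ₐ[ℂ] (K →L[ℂ] K)
  commute : ∀ x y, Commute (left x) (right y)
  left_normal : IsNormalMap M (fun x => left x)
  right_normal : IsNormalMap M (fun x => right (MulOpposite.op x))

namespace HilbertBimodule

variable {M : VonNeumannAlgebra H} {K : Type*} [NormedAddCommGroup K]
    [InnerProductSpace ℂ K] [CompleteSpace K]

/-- The vector `x ξ`. -/
def lact (𝓗 : HilbertBimodule M K) (x : M.toStarSubalgebra) (ξ : K) : K := 𝓗.left x ξ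

/-- The vector `ξ x`. -/
def ract (𝓗 : HilbertBimodule M K) (ξ : K) (x : M.toStarSubalgebra) : K :=
  𝓗.right (MulOpposite.op x) ξ

/-- `ξ` is tracial for `τ`: `⟨x ξ, ξ⟩ = ⟨ξ x, ξ⟩ = τ x` for all `x ∈ M` (Mathlib's inner product is
linear in the second variable, so `⟨x ξ, ξ⟩` is written `inner ℂ ξ (x ξ)`). -/
def IsTracial (𝓗 : HilbertBimodule M K) (τ : M.toStarSubalgebra → ℂ) (ξ : K) : Prop :=
  ∀ x, inner ℂ ξ (𝓗.lact x ξ) = τ x ∧ inner ℂ ξ (𝓗.ract ξ x) = τ x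

/-- `η` is `B`-central: `b η = η b` for all `b ∈ B`. -/
def IsCentral (𝓗 : HilbertBimodule M K) (B : VonNeumannAlgebra H) (η : K) : Prop :=
  ∀ b : M.toStarSubalgebra, (b : H →L[ℂ] H) ∈ B → 𝓗.lact b η = 𝓗.ract η b

end HilbertBimodule

/-- Rigidity (relative property (T)) of the inclusion `B ⊆ M` of von Neumann algebras, where `τ` is
a faithful normal tracial state on `M`: for every `ε > 0` there are a finite set `F ⊆ M` and
`δ > 0` such that for every Hilbert `M`-bimodule and every tracial unit vector `ξ` in it with
`‖x ξ - ξ x‖ ≤ δ` for all `x ∈ F`, there is a `B`-central vector `η` with `‖η - ξ‖ ≤ ε`. -/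
def IsRigid.{w, u} {H : Type u} [NormedAddCommGroup H] [InnerProductSpace ℂ H] [CompleteSpace H]
    (B M : VonNeumannAlgebra H) (τ : M.toStarSubalgebra → ℂ) : Prop :=
  B ≤ M ∧ ∀ ε : ℝ, 0 < ε → ∃ (F : Finset M.toStarSubalgebra) (δ : ℝ), 0 < δ ∧
    ∀ (K : Type w) [NormedAddCommGroup K] [InnerProductSpace ℂ K] [CompleteSpace K]
      (𝓗 : HilbertBimodule M K) (ξ : K), ‖ξ‖ = 1 → 𝓗.IsTracial τ ξ →
      (∀ x ∈ F, ‖𝓗.lact x ξ - 𝓗.ract ξ x‖ ≤ δ) →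
      ∃ η : K, 𝓗.IsCentral B η ∧ ‖η - ξ‖ ≤ ε

end Rigid

/-! ### The crossed product `L^∞(X, μ) ⋊ Γ` and its subalgebras -/

section CrossedProduct

variable (Γ : Type*) [MeasurableSpace Γ] {X : Type*} [MeasurableSpace X] (μ : Measure X)

/-- The Hilbert space `L²(Γ × X, count × μ) = ℓ²(Γ) ⊗ L²(X, μ)`. -/
abbrev CrossedSpace : Type _ := Lp ℂ 2 ((Measure.count : Measure Γ).prod μ)

variable {μ}

/-- The function `(g, x) ↦ f x` in `L^∞(Γ × X)`, for `f ∈ L^∞(X)`. -/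
def amplify [SFinite μ] (f : Lp ℂ ∞ μ) : Lp ℂ ∞ ((Measure.count : Measure Γ).prod μ) :=
  MemLp.toLp (fun z : Γ × X => f z.2) <| by
    refine ⟨(Lp.aestronglyMeasurable f).comp_quasiMeasurePreserving
      Measure.quasiMeasurePreserving_snd, ?_⟩
    have h : ∀ᵐ x ∂μ, ‖f x‖ₑ ≤ eLpNorm f ∞ μ := by
      rw [eLpNorm_exponent_top]; exact enorm_ae_le_eLpNormEssSup f μ
    rw [eLpNorm_exponent_top]
    exact (essSup_le_of_ae_le _ (Measure.quasiMeasurePreserving_snd.ae h)).trans_lt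
      (Lp.eLpNorm_lt_top f)

/-- The operator on `L²` of multiplication by a function in `L^∞`. -/
def mulOp {Z : Type*} [MeasurableSpace Z] {ζ : Measure Z} (φ : Lp ℂ ∞ ζ) :
    Lp ℂ 2 ζ →L[ℂ] Lp ℂ 2 ζ :=
  (ContinuousLinearMap.mul ℂ ℂ).holderL ζ ∞ 2 2 φ

theorem mulOp_apply_ae {Z : Type*} [MeasurableSpace Z] {ζ : Measure Z} (φ : Lp ℂ ∞ ζ)
    (ξ : Lp ℂ 2 ζ) : mulOp φ ξ =ᵐ[ζ] fun z => φ z * ξ z :=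
  (ContinuousLinearMap.mul ℂ ℂ).coeFn_holder (r := 2) φ ξ

/-- The operator on `L²(Γ × X)` by which `f ∈ L^∞(X)` acts: `(f ξ)(g, x) = f x * ξ (g, x)`. -/
def linftyOp [SFinite μ] (f : Lp ℂ ∞ μ) : CrossedSpace Γ μ →L[ℂ] CrossedSpace Γ μ :=
  mulOp (amplify Γ f)

variable {Γ}

theorem linftyOp_apply_ae [SFinite μ] (f : Lp ℂ ∞ μ) (ξ : CrossedSpace Γ μ) :
    linftyOp Γ f ξ =ᵐ[(Measure.count : Measure Γ).prod μ] fun z => f z.2 * ξ z := by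
  have h2 : amplify Γ f =ᵐ[(Measure.count : Measure Γ).prod μ] fun z => f z.2 :=
    MemLp.coeFn_toLp _
  filter_upwards [mulOp_apply_ae (amplify Γ f) ξ, h2] with z hz1 hz2
  rw [← hz2]
  exact hz1

theorem measurePreserving_diag_smul [Group Γ] [Countable Γ] [DiscreteMeasurableSpace Γ]
    [MulAction Γ X] [MeasurableConstSMul Γ X] [SMulInvariantMeasure Γ X μ] [SFinite μ] (g : Γ) :
    MeasurePreserving (fun z : Γ × X => g • z) ((Measure.count : Measure Γ).prod μ)
      ((Measure.count : Measure Γ).prod μ) := by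
  have h1 : MeasurePreserving (fun h : Γ => g * h) Measure.count Measure.count :=
    measurePreserving_mul_left Measure.count g
  exact h1.prod (measurePreserving_smul g μ)

/-- The canonical unitary `u_g` of the crossed product, `(u_g ξ)(h, x) = ξ (g⁻¹ h, g⁻¹ x)`. -/
def groupOp [Group Γ] [Countable Γ] [DiscreteMeasurableSpace Γ] [MulAction Γ X]
    [MeasurableConstSMul Γ X] [SMulInvariantMeasure Γ X μ] [SFinite μ] (g : Γ) :
    CrossedSpace Γ μ →L[ℂ] CrossedSpace Γ μ :=
  (Lp.compMeasurePreservingₗᵢ ℂ (fun z : Γ × X => g⁻¹ • z)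
    (measurePreserving_diag_smul g⁻¹)).toContinuousLinearMap

variable (Γ μ)

/-- The crossed product von Neumann algebra `L^∞(X, μ) ⋊ Γ`, generated on `L²(Γ × X)` by `L^∞(X, μ)`
and the unitaries `u_g`, `g ∈ Γ`. -/
def crossedProduct [Group Γ] [Countable Γ] [DiscreteMeasurableSpace Γ] [MulAction Γ X]
    [MeasurableConstSMul Γ X] [SMulInvariantMeasure Γ X μ] [SFinite μ] :
    VonNeumannAlgebra (CrossedSpace Γ μ) :=
  generatedBy (Set.range (linftyOp (μ := μ) Γ) ∪ Set.range (groupOp (μ := μ) (Γ := Γ)))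

/-- The vector `δ_1 ⊗ 1` of `ℓ²(Γ) ⊗ L²(X, μ)`. -/
def vacuum [Group Γ] [DiscreteMeasurableSpace Γ] [IsFiniteMeasure μ] : CrossedSpace Γ μ :=
  indicatorConstLp 2 (s := ({1} : Set Γ) ×ˢ (Set.univ : Set X))
    ((MeasurableSet.singleton 1).prod MeasurableSet.univ)
    (by rw [Measure.prod_prod, Measure.count_singleton, one_mul]; exact measure_ne_top μ _) 1

/-- The canonical trace `τ(x) = ⟨x (δ_1 ⊗ 1), δ_1 ⊗ 1⟩` of `L^∞(X, μ) ⋊ Γ`; on finite sums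
`∑ f_g u_g` it is `∫ f_1 dμ`. -/
def crossedTrace [Group Γ] [Countable Γ] [DiscreteMeasurableSpace Γ] [MulAction Γ X]
    [MeasurableConstSMul Γ X] [SMulInvariantMeasure Γ X μ] [IsFiniteMeasure μ]
    (x : (crossedProduct Γ μ).toStarSubalgebra) : ℂ :=
  inner ℂ (vacuum Γ μ) ((x : CrossedSpace Γ μ →L[ℂ] CrossedSpace Γ μ) (vacuum Γ μ))

variable {Y : Type*} [MeasurableSpace Y] {ν : Measure Y}
variable {μ}

/-- The copy of `L^∞(Y, ν)` in the operators on `L²(Γ × X)`, for a measure preserving map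
`q : X → Y`: the von Neumann algebra generated by the operators `f ∘ q`, `f ∈ L^∞(Y, ν)`. -/
def factorAlgebra [SFinite μ] (q : X → Y) (hq : MeasurePreserving q μ ν) :
    VonNeumannAlgebra (CrossedSpace Γ μ) :=
  generatedBy (Set.range fun f : Lp ℂ ∞ ν => linftyOp Γ (Lp.compMeasurePreserving q hq f))

end CrossedProduct

/-! ### The algebra generated by `L^∞(Y, ν)` is the image of `L^∞(Y, ν)`

The facts of this section lead to `mem_factorAlgebra_iff`: the elements of `factorAlgebra` are
exactly the operators `f ∘ q`, `f ∈ L^∞(Y, ν)`. -/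

section Identify

variable {Γ : Type*} [MeasurableSpace Γ] {X : Type*} [MeasurableSpace X] {μ : Measure X}
variable {Y : Type*} [MeasurableSpace Y] {ν : Measure Y}

theorem mem_generatedBy_iff {H : Type*} [NormedAddCommGroup H] [InnerProductSpace ℂ H]
    [CompleteSpace H] {S : Set (H →L[ℂ] H)} {T : H →L[ℂ] H} :
    T ∈ generatedBy S ↔ ∀ A : H →L[ℂ] H,
      (∀ s ∈ S, s * A = A * s ∧ star s * A = A * star s) → A * T = T * A := by
  change T ∈ StarSubalgebra.centralizer ℂ (StarSubalgebra.centralizer ℂ S : Set (H →L[ℂ] H)) ↔ _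
  rw [StarSubalgebra.mem_centralizer_iff]
  constructor
  · intro h A hA
    exact (h A ((StarSubalgebra.mem_centralizer_iff ℂ).2 hA)).1
  · intro h A hA
    have hA' := (StarSubalgebra.mem_centralizer_iff ℂ).1 hA
    have hsA := (StarSubalgebra.mem_centralizer_iff ℂ).1 (star_mem hA)
    exact ⟨h A hA', h (star A) hsA⟩

theorem subset_generatedBy {H : Type*} [NormedAddCommGroup H] [InnerProductSpace ℂ H]
    [CompleteSpace H] {S : Set (H →L[ℂ] H)} {T : H →L[ℂ] H} (hT : T ∈ S) : T ∈ generatedBy S :=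
  mem_generatedBy_iff.2 fun _ hA => ((hA T hT).1).symm

theorem ae_fibre [Countable Γ] [DiscreteMeasurableSpace Γ] [SFinite μ] {p : Γ × X → Prop} :
    (∀ᵐ z ∂((Measure.count : Measure Γ).prod μ), p z) ↔ ∀ g, ∀ᵐ x ∂μ, p (g, x) := by
  constructor
  · intro h
    have := Measure.ae_ae_of_ae_prod h
    rwa [Measure.ae_count_iff] at this
  · intro h
    have h2 : ∀ g : Γ, ∀ᵐ z ∂((Measure.count : Measure Γ).prod μ), z.1 = g → p z := by
      intro g
      filter_upwards [Measure.quasiMeasurePreserving_snd.ae (h g)] with z hz h1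
      rw [← h1] at hz
      exact hz
    filter_upwards [ae_all_iff.2 h2] with z hz using hz _ rfl

theorem star_linftyOp [SFinite μ] (f : Lp ℂ ∞ μ) :
    star (linftyOp Γ f) = linftyOp Γ (star f) := by
  rw [ContinuousLinearMap.star_eq_adjoint]
  symm
  rw [ContinuousLinearMap.eq_adjoint_iff]
  intro ξ η
  rw [L2.inner_def, L2.inner_def]
  refine integral_congr_ae ?_
  filter_upwards [linftyOp_apply_ae (Γ := Γ) (star f) ξ, linftyOp_apply_ae (Γ := Γ) f η,
    Measure.quasiMeasurePreserving_snd.ae (Lp.coeFn_star f)] with z h1 h2 h3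
  rw [h1, h2, h3]
  simp [mul_assoc, mul_comm, mul_left_comm]

theorem mulOp_comm {Z : Type*} [MeasurableSpace Z] {ζ : Measure Z} (φ ψ : Lp ℂ ∞ ζ) :
    mulOp φ * mulOp ψ = mulOp ψ * mulOp φ := by
  ext1 ξ
  apply Lp.ext
  simp only [mul_apply_eq_comp]
  filter_upwards [mulOp_apply_ae φ (mulOp ψ ξ), mulOp_apply_ae ψ (mulOp φ ξ),
    mulOp_apply_ae φ ξ, mulOp_apply_ae ψ ξ] with z h1 h2 h3 h4
  rw [h1, h2, h3, h4]; ring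


theorem mp_right [Group Γ] [Countable Γ] [DiscreteMeasurableSpace Γ] [SFinite μ] (g : Γ) :
    MeasurePreserving (fun z : Γ × X => (z.1 * g, z.2)) ((Measure.count : Measure Γ).prod μ)
      ((Measure.count : Measure Γ).prod μ) :=
  (measurePreserving_mul_right Measure.count g).prod (MeasurePreserving.id μ)

/-- Right translation, `(rightOp g ξ)(h, x) = ξ (h g, x)`. -/
def rightOp [Group Γ] [Countable Γ] [DiscreteMeasurableSpace Γ] [SFinite μ] (g : Γ) :
    CrossedSpace Γ μ →L[ℂ] CrossedSpace Γ μ :=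
  (Lp.compMeasurePreservingₗᵢ ℂ (fun z : Γ × X => (z.1 * g, z.2))
    (mp_right g)).toContinuousLinearMap

theorem rightOp_apply_ae [Group Γ] [Countable Γ] [DiscreteMeasurableSpace Γ] [SFinite μ] (g : Γ)
    (ξ : CrossedSpace Γ μ) : rightOp g ξ =ᵐ[(Measure.count : Measure Γ).prod μ]
      fun z => ξ (z.1 * g, z.2) :=
  Lp.coeFn_compMeasurePreserving ξ (mp_right g)

theorem linftyOp_rightOp [Group Γ] [Countable Γ] [DiscreteMeasurableSpace Γ] [SFinite μ]
    (f : Lp ℂ ∞ μ) (g : Γ) : linftyOp Γ f * rightOp g = rightOp g * linftyOp Γ f := by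
  ext1 ξ
  apply Lp.ext
  simp only [mul_apply_eq_comp]
  filter_upwards [linftyOp_apply_ae f (rightOp g ξ), rightOp_apply_ae g ξ,
    rightOp_apply_ae g (linftyOp Γ f ξ),
    (mp_right g).quasiMeasurePreserving.ae (linftyOp_apply_ae f ξ)] with z h1 h2 h3 h4
  rw [h1, h2, h3, h4]

theorem vacuum_ae [Group Γ] [Countable Γ] [DiscreteMeasurableSpace Γ] [IsFiniteMeasure μ] :
    vacuum Γ μ =ᵐ[(Measure.count : Measure Γ).prod μ] fun z =>
      ({1} : Set Γ).indicator (fun _ => 1) z.1 := by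
  filter_upwards [indicatorConstLp_coeFn (p := 2) (μ := (Measure.count : Measure Γ).prod μ)
    (s := ({1} : Set Γ) ×ˢ (Set.univ : Set X))
    (hs := (MeasurableSet.singleton 1).prod MeasurableSet.univ)
    (hμs := by rw [Measure.prod_prod, Measure.count_singleton, one_mul]; exact measure_ne_top μ _)
    (c := (1 : ℂ))] with z hz
  rw [vacuum, hz]
  by_cases h : z.1 = 1 <;> simp [h]

/-- An operator commuting with multiplication operators and right translations, killing the
vacuum vector, vanishes. -/
theorem eq_zero_of_vacuum [Group Γ] [Countable Γ] [DiscreteMeasurableSpace Γ] [IsFiniteMeasure μ]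
    (T : CrossedSpace Γ μ →L[ℂ] CrossedSpace Γ μ)
    (h1 : ∀ φ, mulOp φ * T = T * mulOp φ) (h2 : ∀ g, rightOp g * T = T * rightOp g)
    (h3 : T (vacuum Γ μ) = 0) : T = 0 := by
  classical
  ext1 ξ
  set ζ := (Measure.count : Measure Γ).prod μ

  have key : ∀ (g : Γ) (n : ℕ), ∀ᵐ z ∂ζ, z.1 = g → ‖ξ z‖ ≤ n → T ξ z = 0 := by
    intro g n
    have hm : MeasurableSet {z : Γ × X | z.1 = g ∧ ‖ξ z‖ ≤ n} :=
      (measurable_fst (MeasurableSet.singleton g)).inter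
        (measurableSet_le (Lp.stronglyMeasurable ξ).norm.measurable measurable_const)
    set A := {z : Γ × X | z.1 = g ∧ ‖ξ z‖ ≤ n}
    have hφ : MemLp (A.indicator ξ) ∞ ζ := by
      refine memLp_top_of_bound ((Lp.stronglyMeasurable ξ).indicator hm).aestronglyMeasurable n ?_
      refine Eventually.of_forall fun z => ?_
      by_cases hz : z ∈ A
      · simpa [hz] using hz.2
      · simp [hz]
    have hψ : MemLp (A.indicator fun _ => (1 : ℂ)) ∞ ζ := by
      refine memLp_top_of_bound
        (stronglyMeasurable_const.indicator hm).aestronglyMeasurable 1 ?_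
      refine Eventually.of_forall fun z => ?_
      by_cases hz : z ∈ A <;> simp [hz]
    have e : mulOp hψ.toLp ξ = mulOp hφ.toLp (rightOp g⁻¹ (vacuum Γ μ)) := by
      apply Lp.ext
      filter_upwards [mulOp_apply_ae hψ.toLp ξ, mulOp_apply_ae hφ.toLp (rightOp g⁻¹ (vacuum Γ μ)),
        hψ.coeFn_toLp, hφ.coeFn_toLp, rightOp_apply_ae g⁻¹ (vacuum Γ μ),
        (mp_right g⁻¹).quasiMeasurePreserving.ae (vacuum_ae (Γ := Γ) (μ := μ))]
        with z a1 a2 a3 a4 a5 a6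
      rw [a1, a2, a3, a4, a5, a6]
      by_cases hz : z ∈ A
      · have := hz.1
        simp [hz, this]
      · simp [hz]
    have e2 : mulOp hψ.toLp (T ξ) = 0 := by
      have b1 := congrArg (fun S => S ξ) (h1 hψ.toLp)
      have b2 := congrArg (fun S => S (rightOp g⁻¹ (vacuum Γ μ))) (h1 hφ.toLp)
      have b3 := congrArg (fun S => S (vacuum Γ μ)) (h2 g⁻¹)
      simp only [mul_apply_eq_comp] at b1 b2 b3
      rw [b1, e, ← b2, ← b3, h3, map_zero, map_zero]
    have e3 := mulOp_apply_ae hψ.toLp (T ξ)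
    rw [e2] at e3
    filter_upwards [e3, hψ.coeFn_toLp, Lp.coeFn_zero ℂ 2 ζ] with z c1 c2 c3 c4 c5
    rw [c3, c2] at c1
    have hz : z ∈ A := ⟨c4, c5⟩
    simpa [hz] using c1.symm
  have key' : ∀ᵐ z ∂ζ, ∀ (g : Γ) (n : ℕ), z.1 = g → ‖ξ z‖ ≤ n → T ξ z = 0 :=
    ae_all_iff.2 fun g => ae_all_iff.2 fun n => key g n
  apply Lp.ext
  filter_upwards [key', Lp.coeFn_zero ℂ 2 ζ] with z hz h0
  obtain ⟨n, hn⟩ := exists_nat_ge ‖ξ z‖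
  rw [zero_apply, h0, hz z.1 n rfl hn]
  rfl

theorem mp_fibre [Group Γ] [Countable Γ] [DiscreteMeasurableSpace Γ] [SFinite μ] :
    MeasurePreserving (fun x : X => ((1 : Γ), x)) μ
      (((Measure.count : Measure Γ).prod μ).restrict ({1} ×ˢ Set.univ)) := by
  refine ⟨measurable_prodMk_left, ?_⟩
  rw [← Measure.prod_restrict, Measure.restrict_univ, Measure.restrict_singleton,
    Measure.count_singleton, one_smul, Measure.dirac_prod]

/-- Restriction of `ξ ∈ L²(Γ × X)` to the fibre over `1 ∈ Γ`. -/
def fibreOp [Group Γ] [Countable Γ] [DiscreteMeasurableSpace Γ] [SFinite μ] :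
    CrossedSpace Γ μ →L[ℂ] Lp ℂ 2 μ :=
  (Lp.compMeasurePreservingₗᵢ ℂ (fun x : X => ((1 : Γ), x)) mp_fibre).toContinuousLinearMap.comp
    (LpToLpRestrictCLM (Γ × X) ℂ ℂ ((Measure.count : Measure Γ).prod μ) 2 ({1} ×ˢ Set.univ))

theorem fibreOp_ae [Group Γ] [Countable Γ] [DiscreteMeasurableSpace Γ] [SFinite μ]
    (ξ : CrossedSpace Γ μ) : fibreOp ξ =ᵐ[μ] fun x => ξ (1, x) := by
  have h1 := Lp.coeFn_compMeasurePreserving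
    (LpToLpRestrictCLM (Γ × X) ℂ ℂ ((Measure.count : Measure Γ).prod μ) 2 ({1} ×ˢ Set.univ) ξ)
    (mp_fibre (Γ := Γ) (μ := μ))
  have h2 := (mp_fibre (Γ := Γ) (μ := μ)).quasiMeasurePreserving.ae
    (LpToLpRestrictCLM_coeFn ℂ (μ := (Measure.count : Measure Γ).prod μ) ({1} ×ˢ Set.univ) ξ)
  filter_upwards [h1, h2] with x hx1 hx2
  rw [← hx2]
  exact hx1

/-- The vectors `ξ` whose restriction to the fibre over `1` is `h ∘ q` for some `h ∈ L²(Y)`. -/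
def fibreSpace [Group Γ] [Countable Γ] [DiscreteMeasurableSpace Γ] [SFinite μ] {q : X → Y}
    (hq : MeasurePreserving q μ ν) : Submodule ℂ (CrossedSpace Γ μ) :=
  (LinearMap.range (Lp.compMeasurePreservingₗᵢ (E := ℂ) (p := 2) ℂ q hq).toLinearMap).comap
    (fibreOp (Γ := Γ) (μ := μ)).toLinearMap

theorem mem_fibreSpace_iff [Group Γ] [Countable Γ] [DiscreteMeasurableSpace Γ] [SFinite μ]
    {q : X → Y} (hq : MeasurePreserving q μ ν) {ξ : CrossedSpace Γ μ} :
    ξ ∈ fibreSpace hq ↔ ∃ h : Lp ℂ 2 ν, ∀ᵐ x ∂μ, ξ (1, x) = h (q x) := by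
  change (∃ h : Lp ℂ 2 ν, Lp.compMeasurePreserving q hq h = fibreOp ξ) ↔ _
  refine exists_congr fun h => ⟨fun e => ?_, fun e => ?_⟩
  · have h1 := Lp.coeFn_compMeasurePreserving h hq
    rw [e] at h1
    filter_upwards [h1, fibreOp_ae ξ] with x hx1 hx2
    rw [← hx2, hx1]; rfl
  · apply Lp.ext
    filter_upwards [Lp.coeFn_compMeasurePreserving h hq, fibreOp_ae ξ, e] with x h1 h2 h3
    rw [h1, h2, h3]; rfl

theorem isClosed_fibreSpace [Group Γ] [Countable Γ] [DiscreteMeasurableSpace Γ] [SFinite μ]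
    {q : X → Y} (hq : MeasurePreserving q μ ν) :
    IsClosed (fibreSpace (Γ := Γ) hq : Set (CrossedSpace Γ μ)) := by
  have h1 : IsClosed (Set.range (Lp.compMeasurePreservingₗᵢ (E := ℂ) (p := 2) ℂ q hq)) :=
    (Lp.compMeasurePreservingₗᵢ (E := ℂ) (p := 2) ℂ q hq).isometry.isClosedEmbedding.isClosed_range
  exact h1.preimage (fibreOp (Γ := Γ) (μ := μ)).continuous

theorem linftyOp_mem_fibreSpace [Group Γ] [Countable Γ] [DiscreteMeasurableSpace Γ] [SFinite μ]
    {q : X → Y} (hq : MeasurePreserving q μ ν) (F : Lp ℂ ∞ μ) (f : Lp ℂ ∞ ν)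
    (hF : F =ᵐ[μ] fun x => f (q x)) {ξ : CrossedSpace Γ μ} (hξ : ξ ∈ fibreSpace hq) :
    linftyOp Γ F ξ ∈ fibreSpace hq := by
  rw [mem_fibreSpace_iff] at hξ ⊢
  obtain ⟨h, hh⟩ := hξ
  refine ⟨mulOp f h, ?_⟩
  filter_upwards [ae_fibre.1 (linftyOp_apply_ae (Γ := Γ) F ξ) 1,
    hq.quasiMeasurePreserving.ae (mulOp_apply_ae f h), hF, hh] with x h1 h2 h3 h4
  rw [h1, h2, h3, h4]

theorem eLpNorm_fibre [Group Γ] [Countable Γ] [DiscreteMeasurableSpace Γ] [SFinite μ]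
    {q : X → Y} (hq : MeasurePreserving q μ ν) (ξ : CrossedSpace Γ μ) (h : Y → ℂ)
    (hh : AEStronglyMeasurable h ν) (hξ : ξ =ᵐ[(Measure.count : Measure Γ).prod μ]
      fun z => ({1} : Set Γ).indicator (fun _ => h (q z.2)) z.1) :
    eLpNorm ξ 2 ((Measure.count : Measure Γ).prod μ) = eLpNorm h 2 ν := by
  have e : (fun z : Γ × X => ({1} : Set Γ).indicator (fun _ => h (q z.2)) z.1) =
      (({1} : Set Γ) ×ˢ (Set.univ : Set X)).indicator (fun z => h (q z.2)) := by
    ext z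
    by_cases hz : z.1 = 1 <;> simp [hz]
  rw [eLpNorm_congr_ae hξ, e, eLpNorm_indicator_eq_eLpNorm_restrict
    ((MeasurableSet.singleton 1).prod MeasurableSet.univ)]
  have m1 : AEStronglyMeasurable (fun z : Γ × X => h (q z.2))
      (((Measure.count : Measure Γ).prod μ).restrict ({1} ×ˢ Set.univ)) :=
    ((hh.comp_measurePreserving hq).comp_quasiMeasurePreserving
      Measure.quasiMeasurePreserving_snd).restrict
  rw [← eLpNorm_comp_measurePreserving m1 mp_fibre]
  exact eLpNorm_comp_measurePreserving hh hq

/-- `factorAlgebra` is the image of `L^∞(Y, ν)` under `f ↦ f ∘ q`. -/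
theorem mem_factorAlgebra_iff [Group Γ] [Countable Γ] [DiscreteMeasurableSpace Γ]
    [IsFiniteMeasure μ] {q : X → Y} (hq : MeasurePreserving q μ ν)
    {b : CrossedSpace Γ μ →L[ℂ] CrossedSpace Γ μ} :
    b ∈ factorAlgebra Γ q hq ↔
      ∃ f : Lp ℂ ∞ ν, b = linftyOp Γ (Lp.compMeasurePreserving q hq f) := by
  constructor
  swap
  · rintro ⟨f, rfl⟩
    exact subset_generatedBy ⟨f, rfl⟩
  intro hb
  have : IsFiniteMeasure ν := ⟨by
    rw [← hq.map_eq, Measure.map_apply hq.measurable MeasurableSet.univ]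
    exact measure_lt_top μ _⟩
  rw [factorAlgebra, mem_generatedBy_iff] at hb
  have b1 : ∀ φ, mulOp φ * b = b * mulOp φ := fun φ => hb _ <| by
    rintro _ ⟨f, rfl⟩
    rw [star_linftyOp]
    exact ⟨mulOp_comm _ _, mulOp_comm _ _⟩
  have b2 : ∀ g, rightOp g * b = b * rightOp g := fun g => hb _ <| by
    rintro _ ⟨f, rfl⟩
    rw [star_linftyOp]
    exact ⟨linftyOp_rightOp _ _, linftyOp_rightOp _ _⟩
  have : CompleteSpace (fibreSpace (Γ := Γ) hq) := (isClosed_fibreSpace hq).completeSpace_coe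
  have b3 : (fibreSpace (Γ := Γ) hq).starProjection * b =
      b * (fibreSpace (Γ := Γ) hq).starProjection := by
    refine hb _ ?_
    rintro _ ⟨f, rfl⟩
    have hF := Lp.coeFn_compMeasurePreserving f hq
    have hF' : (star (Lp.compMeasurePreserving q hq f) : Lp ℂ ∞ μ) =ᵐ[μ]
        fun x => (star f : Lp ℂ ∞ ν) (q x) := by
      filter_upwards [Lp.coeFn_star (Lp.compMeasurePreserving q hq f), hF,
        hq.quasiMeasurePreserving.ae (Lp.coeFn_star f)] with x h1 h2 h3
      rw [h1, h3, Pi.star_apply, Pi.star_apply, h2]; rfl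
    have comm : ∀ A : CrossedSpace Γ μ →L[ℂ] CrossedSpace Γ μ,
        (∀ ξ ∈ fibreSpace (Γ := Γ) hq, A ξ ∈ fibreSpace (Γ := Γ) hq) →
        (∀ ξ ∈ fibreSpace (Γ := Γ) hq, star A ξ ∈ fibreSpace (Γ := Γ) hq) →
        A * (fibreSpace (Γ := Γ) hq).starProjection =
          (fibreSpace (Γ := Γ) hq).starProjection * A := by
      intro A hA hA'
      ext1 ξ
      simp only [mul_apply_eq_comp]
      refine (Submodule.eq_starProjection_of_mem_orthogonal
        (hA _ (Submodule.starProjection_apply_mem _ _)) ?_).symm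
      rw [← map_sub, Submodule.mem_orthogonal]
      intro u hu
      rw [← ContinuousLinearMap.adjoint_inner_left, ← ContinuousLinearMap.star_eq_adjoint]
      exact (Submodule.mem_orthogonal _ _).1 (Submodule.sub_starProjection_mem_orthogonal ξ) _
        (hA' u hu)
    have i1 : ∀ ξ ∈ fibreSpace (Γ := Γ) hq,
        linftyOp Γ (Lp.compMeasurePreserving q hq f) ξ ∈ fibreSpace (Γ := Γ) hq :=
      fun ξ hξ => linftyOp_mem_fibreSpace hq _ f hF hξ
    have i2 : ∀ ξ ∈ fibreSpace (Γ := Γ) hq,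
        star (linftyOp Γ (Lp.compMeasurePreserving q hq f)) ξ ∈ fibreSpace (Γ := Γ) hq := by
      intro ξ hξ
      rw [star_linftyOp]
      exact linftyOp_mem_fibreSpace hq _ _ hF' hξ
    exact ⟨comm _ i1 i2, comm _ i2 (by rwa [star_star])⟩
  have hv : vacuum Γ μ ∈ fibreSpace (Γ := Γ) hq := by
    refine (mem_fibreSpace_iff hq).2 ⟨MemLp.toLp (fun _ => (1 : ℂ)) (memLp_const 1), ?_⟩
    filter_upwards [ae_fibre.1 (vacuum_ae (Γ := Γ) (μ := μ)) 1,
      hq.quasiMeasurePreserving.ae (MemLp.coeFn_toLp (memLp_const (1 : ℂ) (p := 2) (μ := ν)))]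
      with x h1 h2
    rw [h1, h2]; simp
  have hbv : b (vacuum Γ μ) ∈ fibreSpace (Γ := Γ) hq := by
    have := congrArg (fun S => S (vacuum Γ μ)) b3
    simp only [mul_apply_eq_comp] at this
    rw [Submodule.starProjection_eq_self_iff.2 hv] at this
    rw [← this]
    exact Submodule.starProjection_apply_mem _ _
  obtain ⟨h, hh⟩ := (mem_fibreSpace_iff hq).1 hbv
  have hL : ∀ F, linftyOp Γ F * b = b * linftyOp Γ F := fun F => b1 _
  -- `b` applied to the vacuum lives on the fibre over `1`
  have hbv' : b (vacuum Γ μ) =ᵐ[(Measure.count : Measure Γ).prod μ]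
      fun z => ({1} : Set Γ).indicator (fun _ => h (q z.2)) z.1 := by
    have hψ : MemLp (fun z : Γ × X => ({1} : Set Γ).indicator (fun _ => (1 : ℂ)) z.1) ∞
        ((Measure.count : Measure Γ).prod μ) := by
      refine memLp_top_of_bound (Measurable.aestronglyMeasurable ?_) 1 ?_
      · exact (measurable_const.indicator (MeasurableSet.singleton 1)).comp measurable_fst
      · refine Eventually.of_forall fun z => ?_
        by_cases hz : z.1 = 1 <;> simp [hz]
    have e : mulOp hψ.toLp (vacuum Γ μ) = vacuum Γ μ := by
      apply Lp.ext
      filter_upwards [mulOp_apply_ae hψ.toLp (vacuum Γ μ), hψ.coeFn_toLp,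
        vacuum_ae (Γ := Γ) (μ := μ)] with z h1 h2 h3
      rw [h1, h2, h3]
      by_cases hz : z.1 = 1 <;> simp [hz]
    have e2 := congrArg (fun S => S (vacuum Γ μ)) (b1 hψ.toLp)
    simp only [mul_apply_eq_comp] at e2
    rw [e] at e2
    have e3 := mulOp_apply_ae hψ.toLp (b (vacuum Γ μ))
    rw [e2] at e3
    have h4 : ∀ᵐ z ∂((Measure.count : Measure Γ).prod μ), z.1 = 1 →
        b (vacuum Γ μ) z = h (q z.2) := by
      refine ae_fibre.2 fun g => ?_
      by_cases hg : g = 1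
      · subst hg
        filter_upwards [hh] with x hx _ using hx
      · exact Eventually.of_forall fun x hx => absurd hx hg
    filter_upwards [e3, hψ.coeFn_toLp, h4] with z h1 h2 h3
    by_cases hz : z.1 = 1
    · rw [h3 hz]; simp [hz]
    · rw [h1, h2]; simp [hz]
  -- the function `h` is essentially bounded
  have hbd : ∀ᵐ y ∂ν, ‖h y‖ ≤ ‖b‖ := by
    have hle : ∀ᵐ y ∂ν, ‖h y‖ₑ ^ (2 : ℝ) ≤ ‖b‖ₑ ^ (2 : ℝ) := by
      refine ae_le_of_forall_setLIntegral_le_of_sigmaFinite₀ ?_ ?_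
      · exact (Lp.aestronglyMeasurable h).enorm.pow_const _
      intro s hs _
      have hφ : MemLp (s.indicator fun _ => (1 : ℂ)) ∞ ν := by
        refine memLp_top_of_bound
          (stronglyMeasurable_const.indicator hs).aestronglyMeasurable 1 ?_
        refine Eventually.of_forall fun z => ?_
        by_cases hz : z ∈ s <;> simp [hz]
      set F := Lp.compMeasurePreserving q hq hφ.toLp
      have hF : ∀ᵐ x ∂μ, F x = s.indicator (fun _ => (1 : ℂ)) (q x) := by
        filter_upwards [Lp.coeFn_compMeasurePreserving hφ.toLp hq,
          hq.quasiMeasurePreserving.ae hφ.coeFn_toLp] with x h1 h2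
        rw [h1, ← h2]; rfl
      have n1 := eLpNorm_fibre hq (linftyOp Γ F (vacuum Γ μ)) (s.indicator fun _ => (1 : ℂ))
        hφ.aestronglyMeasurable <| by
          filter_upwards [linftyOp_apply_ae F (vacuum Γ μ), vacuum_ae (Γ := Γ) (μ := μ),
            Measure.quasiMeasurePreserving_snd.ae hF] with z h1 h2 h3
          rw [h1, h2, h3]
          by_cases hz : z.1 = 1 <;> simp [hz]
      have n2 := eLpNorm_fibre hq (linftyOp Γ F (b (vacuum Γ μ))) (s.indicator h)
        ((Lp.aestronglyMeasurable h).indicator hs) <| by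
          filter_upwards [linftyOp_apply_ae F (b (vacuum Γ μ)), hbv',
            Measure.quasiMeasurePreserving_snd.ae hF] with z h1 h2 h3
          rw [h1, h2, h3]
          by_cases hz : z.1 = 1 <;> by_cases hs : q z.2 ∈ s <;> simp [hz, hs]
      have e2 := congrArg (fun S => S (vacuum Γ μ)) (hL F)
      simp only [mul_apply_eq_comp] at e2
      have n3 : ‖linftyOp Γ F (b (vacuum Γ μ))‖ₑ ≤ ‖b‖ₑ * ‖linftyOp Γ F (vacuum Γ μ)‖ₑ := by
        rw [e2]
        exact b.le_opENorm _
      rw [Lp.enorm_def, Lp.enorm_def, n1, n2, eLpNorm_indicator_eq_eLpNorm_restrict hs,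
        eLpNorm_indicator_eq_eLpNorm_restrict hs] at n3
      have n4 := ENNReal.rpow_le_rpow n3 (z := 2) (by norm_num)
      rw [ENNReal.mul_rpow_of_nonneg _ _ (by norm_num)] at n4
      have p1 := eLpNorm_nnreal_pow_eq_lintegral (f := h) (μ := ν.restrict s) (p := 2) two_ne_zero
      have p2 := eLpNorm_nnreal_pow_eq_lintegral (f := fun _ : Y => (1 : ℂ)) (μ := ν.restrict s)
        (p := 2) two_ne_zero
      norm_num at p1 p2
      norm_num at n4 ⊢
      rw [p1, p2] at n4
      exact n4
    filter_upwards [hle] with y hy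
    rw [ENNReal.rpow_le_rpow_iff (by norm_num)] at hy
    exact enorm_le_iff_norm_le.1 hy |>.trans_eq (by simp)
  have hht : MemLp h ∞ ν := memLp_top_of_bound (Lp.aestronglyMeasurable h) _ hbd
  refine ⟨hht.toLp, ?_⟩
  rw [← sub_eq_zero]
  refine eq_zero_of_vacuum _ ?_ ?_ ?_
  · intro φ
    rw [mul_sub, sub_mul, b1, linftyOp, mulOp_comm]
  · intro g
    rw [mul_sub, sub_mul, b2, linftyOp_rightOp]
  · rw [sub_apply, sub_eq_zero]
    apply Lp.ext
    filter_upwards [hbv', linftyOp_apply_ae (Lp.compMeasurePreserving q hq hht.toLp) (vacuum Γ μ),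
      vacuum_ae (Γ := Γ) (μ := μ), Measure.quasiMeasurePreserving_snd.ae
        (Lp.coeFn_compMeasurePreserving hht.toLp hq), Measure.quasiMeasurePreserving_snd.ae
        (hq.quasiMeasurePreserving.ae hht.coeFn_toLp)] with z h1 h2 h3 h4 h5
    rw [h1, h2, h3, h4, Function.comp_apply, h5]
    by_cases hz : z.1 = 1 <;> simp [hz]

theorem factorAlgebra_le_crossedProduct [Group Γ] [Countable Γ] [DiscreteMeasurableSpace Γ]
    [MulAction Γ X] [MeasurableConstSMul Γ X] [SMulInvariantMeasure Γ X μ] [IsFiniteMeasure μ]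
    {q : X → Y} (hq : MeasurePreserving q μ ν) :
    factorAlgebra Γ q hq ≤ crossedProduct Γ μ := by
  intro b hb
  obtain ⟨f, rfl⟩ := (mem_factorAlgebra_iff hq).1 hb
  exact subset_generatedBy (Or.inl ⟨_, rfl⟩)

end Identify

/-! ### Distance of measures -/

/-- `‖μ - ν‖`, the supremum of `|∫ f dμ - ∫ f dν|` over the complex Borel functions `f` with
`|f| ≤ 1`. -/
def measureDist {Z : Type*} [MeasurableSpace Z] (μ ν : Measure Z) : ℝ :=
  sSup {r : ℝ | ∃ f : Z → ℂ, Measurable f ∧ (∀ z, ‖f z‖ ≤ 1) ∧ r = ‖∫ z, f z ∂μ - ∫ z, f z ∂ν‖}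

end RigidInclusion
end

universe w u v t

open RigidInclusion

/-! A tracial vector `ξ` of a bimodule over the crossed product carries two commuting
representations of the bounded measurable functions on `X`, hence a joint distribution: a
probability measure `m` on `X × X` with `∫ f₁(x) f₂(y) dm = ⟨f₁ ξ f₂, ξ⟩`, whose marginals are `μ`
because `ξ` is tracial (`exists_jointMeasure`). Commutation properties of `ξ` become properties of
`m` (`exists_measure_of_isTracial`). First, `‖f ξ - ξ f‖² = ∫ |f(x) - f(y)|² dm`. Second,
conjugating `ξ` by a canonical unitary translates `m`; since the distance of joint distributions is
at most twice the distance of the vectors, a vector almost commuting with the unitary has an almost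
invariant measure.

If rigidity fails for `ε`, choose tracial vectors with no central vector within `ε` that commute up
to `1/(n+1)` with the first `n` canonical unitaries and with one function `j`, an embedding of `X`
in `[0, 1]`. Their measures are asymptotically invariant. Control of the single function `j` gives
condition (i) for all bounded measurable functions, because each of them is a measurable function of
`j`, approximable by continuous ones (`tendsto_integral_norm_sub`, `tendsto_integral_mul`). The
concentration hypothesis therefore sends the mass of `{q x = q y}` to `1`.

On the other hand, let that mass be at least `1 - ε²/4`. A unitary `b` of the factor algebra is a
function of `q` of modulus one, so `‖b ξ - ξ b‖² ≤ 4 · ε²/4`. All vectors `b ξ b*` then lie within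
`ε` of `ξ`, and the element of least norm in their closed convex hull is central
(`exists_fixed_vector`, `exists_isCentral`, `exists_isCentral_of_measure_ge`). This is the
contradiction. -/

namespace RigidInclusion

/-! ### Joint continuous functional calculus of two commuting representations. -/

section JointCalculus

open ContinuousMap

/-- The inclusion of the unit interval in `ℂ`, as a continuous function. -/
noncomputable def unitCoord : C(unitInterval, ℂ) := ⟨fun t => ((t : ℝ) : ℂ), by fun_prop⟩

theorem star_unitCoord : star unitCoord = unitCoord := by
  ext t
  simp [unitCoord]

variable {A : Type*} [CStarAlgebra A]

theorem continuous_starAlgHom {B : Type*} [CStarAlgebra B] (φ : B →⋆ₐ[ℂ] A) : Continuous φ :=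
  AddMonoidHomClass.continuous_of_bound φ 1 fun x => by
    simpa using NonUnitalStarAlgHom.norm_apply_le φ x

/-- Stone–Weierstrass: the equalizer is a closed star subalgebra, and it separates points because it
contains the coordinate function. -/
theorem starAlgHom_unitInterval_ext {φ ψ : C(unitInterval, ℂ) →⋆ₐ[ℂ] A}
    (h : φ unitCoord = ψ unitCoord) : φ = ψ := by
  let E : StarSubalgebra ℂ C(unitInterval, ℂ) := StarAlgHom.equalizer φ ψ
  have hsep : E.SeparatesPoints := by
    intro x y hxy
    refine ⟨unitCoord, ⟨unitCoord, h, rfl⟩, fun e => hxy ?_⟩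
    simpa [unitCoord, Subtype.ext_iff] using e
  have hcl : IsClosed (E : Set C(unitInterval, ℂ)) :=
    isClosed_eq (continuous_starAlgHom φ) (continuous_starAlgHom ψ)
  have htop := starSubalgebra_topologicalClosure_eq_top_of_separatesPoints E hsep
  ext1 f
  have hf : f ∈ E.topologicalClosure := htop ▸ StarSubalgebra.mem_top
  exact (StarSubalgebra.topologicalClosure_minimal le_rfl hcl) hf

/-- Two commuting representations of `C([0,1])` come from one representation of
`C([0,1] × [0,1])`. -/
theorem exists_joint_starAlgHom (Φ Ψ : C(unitInterval, ℂ) →⋆ₐ[ℂ] A)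
    (hcomm : ∀ f g, Commute (Φ f) (Ψ g)) :
    ∃ Θ : C(unitInterval × unitInterval, ℂ) →⋆ₐ[ℂ] A,
      (∀ g, Θ (g.comp ContinuousMap.fst) = Φ g) ∧ ∀ g, Θ (g.comp ContinuousMap.snd) = Ψ g := by
  set a := Φ unitCoord
  set b := Ψ unitCoord
  have ha : star a = a := by rw [← map_star, star_unitCoord]
  have hb : star b = b := by rw [← map_star, star_unitCoord]
  have hab : Commute a b := hcomm _ _
  -- Commuting self-adjoint elements are the real and imaginary parts of one normal element, so the
  -- one-variable calculus of `c` is the two-variable calculus of `(a, b)`.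
  set c : A := a + Complex.I • b
  have hsc : star c = a - Complex.I • b := by
    simp [c, ha, hb, sub_eq_add_neg]
  have hc : IsStarNormal c := by
    refine ⟨?_⟩
    rw [hsc]
    refine ((Commute.refl a).sub_left (hab.symm.smul_left _)).add_right ?_
    exact ((hab.smul_right _).sub_left (((Commute.refl b).smul_left _).smul_right _))
  have hre : (realPart c : A) = a := by
    rw [realPart_apply_coe, hsc]
    simp only [c]
    rw [show a + Complex.I • b + (a - Complex.I • b) = (2 : ℝ) • a by rw [two_smul]; abel,
      smul_smul]
    norm_num
  have him : (imaginaryPart c : A) = b := by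
    rw [imaginaryPart_apply_coe, hsc]
    simp only [c]
    rw [show a + Complex.I • b - (a - Complex.I • b) = (2 : ℝ) • Complex.I • b by
      rw [two_smul]; abel, smul_smul (2⁻¹ : ℝ), inv_mul_cancel₀ (two_ne_zero' ℝ), one_smul,
      smul_smul]
    simp
  -- Homomorphisms do not enlarge spectra. By spectral mapping for `re` and `im`, this places the
  -- spectrum of `c` in the unit square.
  have hspec : ∀ Ξ : C(unitInterval, ℂ) →⋆ₐ[ℂ] A, ∀ z ∈ spectrum ℂ (Ξ unitCoord),
      ∃ t : unitInterval, z = ((t : ℝ) : ℂ) := by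
    intro Ξ z hz
    have := AlgHom.spectrum_apply_subset Ξ unitCoord hz
    rw [ContinuousMap.spectrum_eq_range] at this
    obtain ⟨t, rfl⟩ := this
    exact ⟨t, rfl⟩
  have hcr : Continuous fun z : ℂ => ((z.re : ℝ) : ℂ) := by fun_prop
  have hci : Continuous fun z : ℂ => ((z.im : ℝ) : ℂ) := by fun_prop
  have hre' : ∀ z ∈ spectrum ℂ c, z.re ∈ unitInterval := by
    intro z hz
    have : ((z.re : ℝ) : ℂ) ∈ spectrum ℂ a := by
      rw [← hre, ← cfc_re_id c, cfc_map_spectrum (fun z : ℂ => ((z.re : ℝ) : ℂ)) c hc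
        hcr.continuousOn]
      exact ⟨z, hz, rfl⟩
    obtain ⟨t, ht⟩ := hspec _ _ this
    rw [Complex.ofReal_inj] at ht
    exact ht ▸ t.2
  have him' : ∀ z ∈ spectrum ℂ c, z.im ∈ unitInterval := by
    intro z hz
    have : ((z.im : ℝ) : ℂ) ∈ spectrum ℂ b := by
      rw [← him, ← cfc_im_id c, cfc_map_spectrum (fun z : ℂ => ((z.im : ℝ) : ℂ)) c hc
        hci.continuousOn]
      exact ⟨z, hz, rfl⟩
    obtain ⟨t, ht⟩ := hspec _ _ this
    rw [Complex.ofReal_inj] at ht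
    exact ht ▸ t.2
  let p : C(spectrum ℂ c, unitInterval × unitInterval) :=
    ⟨fun z => (⟨z.1.re, hre' z z.2⟩, ⟨z.1.im, him' z z.2⟩), by fun_prop⟩
  let Θ : C(unitInterval × unitInterval, ℂ) →⋆ₐ[ℂ] A :=
    (cfcHom hc).comp (ContinuousMap.compStarAlgHom' ℂ ℂ p)
  refine ⟨Θ, fun g => ?_, fun g => ?_⟩
  · refine DFunLike.congr_fun (starAlgHom_unitInterval_ext (φ := Θ.comp
      (ContinuousMap.compStarAlgHom' ℂ ℂ ContinuousMap.fst)) (ψ := Φ) ?_) g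
    change cfcHom hc _ = a
    rw [← hre, ← cfc_re_id c, cfc_apply _ c hc hcr.continuousOn]
    rfl
  · refine DFunLike.congr_fun (starAlgHom_unitInterval_ext (φ := Θ.comp
      (ContinuousMap.compStarAlgHom' ℂ ℂ ContinuousMap.snd)) (ψ := Ψ) ?_) g
    change cfcHom hc _ = b
    rw [← him, ← cfc_im_id c, cfc_apply _ c hc hci.continuousOn]
    rfl

end JointCalculus

/-! ### Scalar spectral measures and their dependence on the vector. -/

section SpectralMeasure

variable {K : Type*} [NormedAddCommGroup K] [InnerProductSpace ℂ K] [CompleteSpace K]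
variable {S : Type*} [TopologicalSpace S]

/-- A real continuous function, viewed as a complex one. -/
def ofRealCont (f : C(S, ℝ)) : C(S, ℂ) := ⟨fun s => (f s : ℂ), by fun_prop⟩

/-- With `g = √f` the operator is `Θ(g)* Θ(g)`, so its vector state is a squared norm. -/
theorem inner_self_starAlgHom_nonneg (Θ : C(S, ℂ) →⋆ₐ[ℂ] (K →L[ℂ] K)) (ξ : K) (f : C(S, ℝ))
    (hf : 0 ≤ f) : 0 ≤ (inner ℂ ξ (Θ (ofRealCont f) ξ) : ℂ).re := by
  let g : C(S, ℝ) := ⟨fun s => Real.sqrt (f s), by fun_prop⟩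
  have e : ofRealCont f = star (ofRealCont g) * ofRealCont g := by
    ext s
    have : Real.sqrt (f s) * Real.sqrt (f s) = f s := Real.mul_self_sqrt (hf s)
    simp only [ofRealCont, g, ContinuousMap.coe_mk, ContinuousMap.mul_apply,
      ContinuousMap.star_apply, RCLike.star_def, Complex.conj_ofReal]
    rw [← Complex.ofReal_mul, this]
  rw [e, map_mul, map_star, ContinuousLinearMap.star_eq_adjoint, mul_apply_eq_comp,
    ContinuousLinearMap.adjoint_inner_right]
  exact inner_self_nonneg (𝕜 := ℂ)

theorem inner_self_starAlgHom_ofReal (Θ : C(S, ℂ) →⋆ₐ[ℂ] (K →L[ℂ] K)) (ξ : K) (f : C(S, ℝ)) :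
    (((inner ℂ ξ (Θ (ofRealCont f) ξ) : ℂ).re : ℝ) : ℂ) = inner ℂ ξ (Θ (ofRealCont f) ξ) := by
  have e : star (ofRealCont f) = ofRealCont f := by
    ext s
    simp [ofRealCont]
  have h : ContinuousLinearMap.adjoint (Θ (ofRealCont f)) = Θ (ofRealCont f) := by
    rw [← ContinuousLinearMap.star_eq_adjoint, ← map_star, e]
  refine Complex.conj_eq_iff_re.1 ?_
  rw [inner_conj_symm, ← ContinuousLinearMap.adjoint_inner_right, h]

/-- The scalar spectral measure of a vector, for a representation of `C(S)`. -/
theorem exists_spectralMeasure [CompactSpace S] [T2Space S] [MeasurableSpace S] [BorelSpace S]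
    (Θ : C(S, ℂ) →⋆ₐ[ℂ] (K →L[ℂ] K)) (ξ : K) :
    ∃ m : Measure S, IsFiniteMeasure m ∧ ∀ f : C(S, ℂ), ∫ s, f s ∂m = inner ℂ ξ (Θ f ξ) := by
  -- The vector state on real functions, to be represented by Riesz–Markov. Taking the real part
  -- loses nothing, by `inner_self_starAlgHom_ofReal`.
  let Λ₀ : CompactlySupportedContinuousMap S ℝ →ₗ[ℝ] ℝ :=
    { toFun := fun f => (inner ℂ ξ (Θ (ofRealCont f.toContinuousMap) ξ) : ℂ).re
      map_add' := fun f g => by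
        have e : ofRealCont (f + g).toContinuousMap =
            ofRealCont f.toContinuousMap + ofRealCont g.toContinuousMap := by
          ext s
          simp [ofRealCont]
        rw [e, map_add, add_apply, inner_add_right, Complex.add_re]
      map_smul' := fun r f => by
        have e : ofRealCont (r • f).toContinuousMap = (r : ℂ) • ofRealCont f.toContinuousMap := by
          ext s
          simp [ofRealCont]
        rw [e, map_smul, smul_apply, inner_smul_right, Complex.re_ofReal_mul]
        rfl }
  let Λ := PositiveLinearMap.mk₀ Λ₀ fun f hf =>
    inner_self_starAlgHom_nonneg Θ ξ f.toContinuousMap hf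
  have hreal : ∀ f : C(S, ℝ), ∫ s, f s ∂(RealRMK.rieszMeasure Λ) =
      (inner ℂ ξ (Θ (ofRealCont f) ξ) : ℂ).re := fun f =>
    RealRMK.integral_rieszMeasure Λ (CompactlySupportedContinuousMap.continuousMapEquiv f)
  have hfin : IsFiniteMeasure (RealRMK.rieszMeasure Λ) := inferInstance
  refine ⟨RealRMK.rieszMeasure Λ, hfin, fun f => ?_⟩
  let u : C(S, ℝ) := ⟨fun s => (f s).re, by fun_prop⟩
  let v : C(S, ℝ) := ⟨fun s => (f s).im, by fun_prop⟩
  have e : f = ofRealCont u + Complex.I • ofRealCont v := by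
    ext s
    simp only [ofRealCont, u, v, ContinuousMap.add_apply, ContinuousMap.coe_mk,
      ContinuousMap.smul_apply, smul_eq_mul]
    rw [mul_comm]
    exact (Complex.re_add_im _).symm
  have hu := congrArg (fun x : ℝ => (x : ℂ)) (hreal u)
  have hv := congrArg (fun x : ℝ => (x : ℂ)) (hreal v)
  simp only [inner_self_starAlgHom_ofReal, ← integral_complex_ofReal] at hu hv
  have iu : Integrable (fun s => ((u s : ℝ) : ℂ)) (RealRMK.rieszMeasure Λ) :=
    (ofRealCont u).continuous.integrable_of_hasCompactSupport (HasCompactSupport.of_compactSpace _)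
  have iv : Integrable (fun s => ((v s : ℝ) : ℂ)) (RealRMK.rieszMeasure Λ) :=
    (ofRealCont v).continuous.integrable_of_hasCompactSupport (HasCompactSupport.of_compactSpace _)
  have e2 : (fun s => f s) = fun s => ((u s : ℝ) : ℂ) + Complex.I * ((v s : ℝ) : ℂ) := by
    ext s
    exact DFunLike.congr_fun e s
  rw [e2, integral_add iu (iv.const_mul _), integral_const_mul, hu, hv]
  conv_rhs => rw [e]
  rw [map_add, map_smul, add_apply, smul_apply, inner_add_right, inner_smul_right]

theorem norm_starAlgHom_apply_le [CompactSpace S] (Θ : C(S, ℂ) →⋆ₐ[ℂ] (K →L[ℂ] K)) (f : C(S, ℂ))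
    (hf : ∀ s, ‖f s‖ ≤ 1) (ξ : K) : ‖Θ f ξ‖ ≤ ‖ξ‖ := by
  have h1 : ‖Θ f‖ ≤ 1 := (NonUnitalStarAlgHom.norm_apply_le Θ f).trans
    ((ContinuousMap.norm_le _ zero_le_one).2 hf)
  simpa using (Θ f).le_of_opNorm_le h1 ξ

/-- The vector is changed in one slot of the inner product at a time, and `Θ f` is a contraction.
This makes nearby unit vectors have nearby spectral measures. -/
theorem norm_inner_sub_inner_le [CompactSpace S] (Θ : C(S, ℂ) →⋆ₐ[ℂ] (K →L[ℂ] K)) (f : C(S, ℂ))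
    (hf : ∀ s, ‖f s‖ ≤ 1) {ξ η : K} (hξ : ‖ξ‖ = 1) (hη : ‖η‖ = 1) :
    ‖inner ℂ ξ (Θ f ξ) - inner ℂ η (Θ f η)‖ ≤ 2 * ‖ξ - η‖ := by
  have e : (inner ℂ ξ (Θ f ξ) - inner ℂ η (Θ f η) : ℂ) =
      inner ℂ (ξ - η) (Θ f ξ) + inner ℂ η (Θ f (ξ - η)) := by
    rw [inner_sub_left, map_sub, inner_sub_right]; ring
  rw [e]
  refine (norm_add_le _ _).trans ?_
  have h1 := norm_inner_le_norm (𝕜 := ℂ) (ξ - η) (Θ f ξ)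
  have h2 := norm_inner_le_norm (𝕜 := ℂ) η (Θ f (ξ - η))
  have h3 := norm_starAlgHom_apply_le Θ f hf ξ
  have h4 := norm_starAlgHom_apply_le Θ f hf (ξ - η)
  rw [hξ] at h3
  rw [hη, one_mul] at h2
  nlinarith [norm_nonneg (ξ - η)]

end SpectralMeasure

/-! ### Distance of measures, tested on continuous functions. -/

section TotalVariation

variable {S : Type*} [TopologicalSpace S] [NormalSpace S]
  [MeasurableSpace S] [BorelSpace S]

/-- The distance of two measures on a normal space can be computed with continuous functions. -/
theorem measureDist_le_of_continuous (m m' : Measure S) [IsFiniteMeasure m] [IsFiniteMeasure m']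
    [(m + m').WeaklyRegular] {c : ℝ} (hc : 0 ≤ c)
    (h : ∀ f : C(S, ℂ), (∀ s, ‖f s‖ ≤ 1) → ‖∫ s, f s ∂m - ∫ s, f s ∂m'‖ ≤ c) :
    measureDist m m' ≤ c := by
  refine Real.sSup_le ?_ hc
  rintro _ ⟨f, hfm, hf1, rfl⟩
  refine le_of_forall_pos_le_add fun ε hε => ?_
  have hfL : MemLp f 1 (m + m') :=
    (memLp_top_of_bound hfm.aestronglyMeasurable 1 (Eventually.of_forall hf1)).mono_exponent le_top
  -- Approximating in `L¹(m + m')` gives one `g` that serves both measures.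
  obtain ⟨g, hg, hgL⟩ := hfL.exists_boundedContinuous_eLpNorm_sub_le ENNReal.one_ne_top
    (ε := ENNReal.ofReal (ε / 2)) (by simpa using hε)
  have hgi : Integrable (fun s => ‖f s - g s‖) (m + m') := (memLp_one_iff_integrable.1
    (hfL.sub hgL)).norm
  have hfg : ∫ s, ‖f s - g s‖ ∂(m + m') ≤ ε / 2 := by
    rw [eLpNorm_one_eq_lintegral_enorm] at hg
    exact (integral_norm_eq_lintegral_enorm (hfL.sub hgL).1).trans_le
      (ENNReal.toReal_le_of_le_ofReal (by positivity) hg)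
  -- Radial retraction of `g` to the closed unit disc, so that `h` applies. As `f` already takes
  -- values in the disc, this at most doubles the error, whence the `ε / 2` above.
  let k : C(S, ℂ) := ⟨fun s => ((max 1 ‖g s‖)⁻¹ : ℝ) • g s, by
    have : ∀ s, max 1 ‖g s‖ ≠ 0 := fun s => (lt_max_of_lt_left one_pos).ne'
    have hgc := g.continuous
    fun_prop (disch := exact this _)⟩
  have hk1 : ∀ s, ‖k s‖ ≤ 1 := by
    intro s
    have h0 : 0 < max 1 ‖g s‖ := lt_max_of_lt_left one_pos
    simp only [k, ContinuousMap.coe_mk, norm_smul, norm_inv, Real.norm_of_nonneg h0.le]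
    rw [inv_mul_le_one₀ h0]
    exact le_max_right _ _
  have hfk : ∀ s, ‖f s - k s‖ ≤ 2 * ‖f s - g s‖ := by
    intro s
    have hgk : ‖g s - k s‖ ≤ ‖f s - g s‖ := by
      rcases le_total ‖g s‖ 1 with h1 | h1
      · simp [k, h1]
      · have h0 : ‖g s‖ ≠ 0 := by positivity
        have e : g s - k s = (1 - ‖g s‖⁻¹ : ℝ) • g s := by
          simp only [k, ContinuousMap.coe_mk, max_eq_right h1, sub_smul, one_smul]
        rw [e, norm_smul, Real.norm_of_nonneg (sub_nonneg.2 (inv_le_one_of_one_le₀ h1)), sub_mul,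
          inv_mul_cancel₀ h0, one_mul]
        have := norm_sub_norm_le (g s) (f s)
        rw [norm_sub_rev] at this
        linarith [hf1 s]
    have := norm_sub_le_norm_sub_add_norm_sub (f s) (g s) (k s)
    linarith
  have hi : ∀ n : Measure S, IsFiniteMeasure n → Integrable f n ∧ Integrable k n := fun n _ =>
    ⟨memLp_one_iff_integrable.1 ((memLp_top_of_bound hfm.aestronglyMeasurable 1
      (Eventually.of_forall hf1)).mono_exponent le_top),
     memLp_one_iff_integrable.1 ((memLp_top_of_bound k.continuous.measurable.aestronglyMeasurable 1
      (Eventually.of_forall hk1)).mono_exponent le_top)⟩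
  have hgm := integrable_add_measure.1 hgi
  have key : ∀ n : Measure S, IsFiniteMeasure n → Integrable (fun s => ‖f s - g s‖) n →
      ‖∫ s, f s ∂n - ∫ s, k s ∂n‖ ≤ 2 * ∫ s, ‖f s - g s‖ ∂n := by
    intro n hn hgn
    rw [← integral_sub (hi n hn).1 (hi n hn).2, ← integral_const_mul]
    exact norm_integral_le_of_norm_le (hgn.const_mul 2) (Eventually.of_forall hfk)
  have k1 := key m inferInstance hgm.1
  have k2 := key m' inferInstance hgm.2
  rw [integral_add_measure hgm.1 hgm.2] at hfg
  have e : ∫ s, f s ∂m - ∫ s, f s ∂m' = (∫ s, f s ∂m - ∫ s, k s ∂m) +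
      (∫ s, k s ∂m - ∫ s, k s ∂m') - (∫ s, f s ∂m' - ∫ s, k s ∂m') := by ring
  rw [e]
  refine (norm_sub_le _ _).trans ((add_le_add (norm_add_le _ _) le_rfl).trans ?_)
  linarith [h k hk1]

theorem measureDist_nonneg {Z : Type*} [MeasurableSpace Z] (m m' : Measure Z) :
    0 ≤ measureDist m m' :=
  Real.sSup_nonneg (by rintro _ ⟨f, _, _, rfl⟩; exact norm_nonneg _)

theorem bddAbove_measureDist {Z : Type*} [MeasurableSpace Z] (m m' : Measure Z)
    [IsFiniteMeasure m] [IsFiniteMeasure m'] :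
    BddAbove {r : ℝ | ∃ f : Z → ℂ, Measurable f ∧ (∀ z, ‖f z‖ ≤ 1) ∧
      r = ‖∫ z, f z ∂m - ∫ z, f z ∂m'‖} := by
  refine ⟨1 * m.real Set.univ + 1 * m'.real Set.univ, ?_⟩
  rintro _ ⟨f, _, hf, rfl⟩
  exact (norm_sub_le _ _).trans (add_le_add
    (norm_integral_le_of_norm_le_const (Eventually.of_forall hf))
    (norm_integral_le_of_norm_le_const (Eventually.of_forall hf)))

/-- The distance of measures does not increase under push-forward. -/
theorem measureDist_map_le {Z W : Type*} [MeasurableSpace Z] [MeasurableSpace W]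
    (m m' : Measure Z) [IsFiniteMeasure m] [IsFiniteMeasure m'] {r : Z → W} (hr : Measurable r) :
    measureDist (m.map r) (m'.map r) ≤ measureDist m m' := by
  refine Real.sSup_le ?_ (measureDist_nonneg m m')
  rintro _ ⟨f, hfm, hf1, rfl⟩
  rw [integral_map hr.aemeasurable hfm.aestronglyMeasurable,
    integral_map hr.aemeasurable hfm.aestronglyMeasurable]
  exact le_csSup (bddAbove_measureDist m m') ⟨fun z => f (r z), hfm.comp hr, fun z => hf1 _, rfl⟩

end TotalVariation

/-! ### The algebra of bounded measurable functions and its `L²`-seminorm. -/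

section BoundedMeasurable

/-- The algebra of bounded measurable complex functions on `Z`. -/
def boundedMeasurable (Z : Type*) [MeasurableSpace Z] : StarSubalgebra ℂ (Z → ℂ) where
  carrier := {f | Measurable f ∧ ∃ C : ℝ, ∀ z, ‖f z‖ ≤ C}
  mul_mem' := by
    rintro f g ⟨hf, C, hC⟩ ⟨hg, D, hD⟩
    refine ⟨hf.mul hg, C * D, fun z => ?_⟩
    rw [Pi.mul_apply, norm_mul]
    exact mul_le_mul (hC z) (hD z) (norm_nonneg _) ((norm_nonneg _).trans (hC z))
  add_mem' := by
    rintro f g ⟨hf, C, hC⟩ ⟨hg, D, hD⟩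
    exact ⟨hf.add hg, C + D, fun z => (norm_add_le _ _).trans (add_le_add (hC z) (hD z))⟩
  algebraMap_mem' := fun c => ⟨measurable_const, ‖c‖, fun _ => le_rfl⟩
  star_mem' := by
    rintro f ⟨hf, C, hC⟩
    exact ⟨continuous_star.measurable.comp hf, C, fun z => by simpa using hC z⟩

variable {Z W : Type*} [MeasurableSpace Z] [MeasurableSpace W]

theorem memLp_boundedMeasurable (f : boundedMeasurable Z) (p : ℝ≥0∞) (m : Measure Z)
    [IsFiniteMeasure m] : MemLp f.1 p m := by
  obtain ⟨C, hC⟩ := f.2.2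
  exact (memLp_top_of_bound f.2.1.aestronglyMeasurable C
    (Eventually.of_forall hC)).mono_exponent le_top

theorem integrable_boundedMeasurable (f : boundedMeasurable Z) (m : Measure Z)
    [IsFiniteMeasure m] : Integrable f.1 m :=
  memLp_one_iff_integrable.1 (memLp_boundedMeasurable f 1 m)

/-- Composition with a measurable map. -/
def compHom (r : Z → W) (hr : Measurable r) : boundedMeasurable W →⋆ₐ[ℂ] boundedMeasurable Z where
  toFun f := ⟨fun z => f.1 (r z), f.2.1.comp hr, f.2.2.imp fun _ h _ => h _⟩
  map_one' := rfl
  map_mul' _ _ := rfl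
  map_zero' := rfl
  map_add' _ _ := rfl
  commutes' _ := rfl
  map_star' _ := rfl

/-- Continuous functions on a compact space are bounded and measurable. -/
noncomputable def contHom (S : Type*) [TopologicalSpace S] [CompactSpace S] [MeasurableSpace S] [BorelSpace S] :
    C(S, ℂ) →⋆ₐ[ℂ] boundedMeasurable S where
  toFun f := ⟨f, f.continuous.measurable, ‖f‖, f.norm_coe_le_norm⟩
  map_one' := rfl
  map_mul' _ _ := rfl
  map_zero' := rfl
  map_add' _ _ := rfl
  commutes' _ := rfl
  map_star' _ := rfl

/-- The `L²`-seminorm. -/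
noncomputable def l2norm (m : Measure Z) (f : boundedMeasurable Z) : ℝ := (eLpNorm f.1 2 m).toReal

theorem l2norm_sq (m : Measure Z) [IsFiniteMeasure m] (f : boundedMeasurable Z) :
    (l2norm m f) ^ 2 = ∫ z, ‖f.1 z‖ ^ 2 ∂m := by
  rw [l2norm, (memLp_boundedMeasurable f 2 m).eLpNorm_eq_integral_rpow_norm two_ne_zero ENNReal.ofNat_ne_top]
  have h0 : 0 ≤ ∫ z, ‖f.1 z‖ ^ 2 ∂m := integral_nonneg fun _ => by positivity
  norm_num
  rw [ENNReal.toReal_ofReal (by positivity), ← Real.sqrt_eq_rpow, Real.sq_sqrt h0]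

theorem integral_norm_le_l2norm (m : Measure Z) [IsProbabilityMeasure m]
    (f : boundedMeasurable Z) : ∫ z, ‖f.1 z‖ ∂m ≤ l2norm m f := by
  rw [integral_norm_eq_lintegral_enorm (memLp_boundedMeasurable f 1 m).1, ← eLpNorm_one_eq_lintegral_enorm]
  exact ENNReal.toReal_mono (memLp_boundedMeasurable f 2 m).eLpNorm_ne_top
    (eLpNorm_le_eLpNorm_of_exponent_le (by norm_num) (memLp_boundedMeasurable f 1 m).1)

/-- An additive function on bounded measurable functions that is `L²`-bounded and vanishes on
continuous functions vanishes. -/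
theorem eq_zero_of_continuous {S : Type*} [TopologicalSpace S] [CompactSpace S] [NormalSpace S]
    [MeasurableSpace S] [BorelSpace S] (m : Measure S) [IsFiniteMeasure m] [m.WeaklyRegular]
    (d : boundedMeasurable S → ℂ) (hsub : ∀ f g, d (f - g) = d f - d g) (C : ℝ)
    (hC : ∀ f, ‖d f‖ ≤ C * l2norm m f) (h0 : ∀ g, d (contHom S g) = 0)
    (f : boundedMeasurable S) : d f = 0 := by
  have key : ∀ ε : ℝ, 0 < ε → ‖d f‖ ≤ |C| * ε := by
    intro ε hε
    obtain ⟨g, hg, -⟩ := (memLp_boundedMeasurable f 2 m).exists_boundedContinuous_eLpNorm_sub_le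
      ENNReal.ofNat_ne_top (ε := ENNReal.ofReal ε) (by simpa using hε)
    have h1 := hC (f - contHom S g.toContinuousMap)
    rw [hsub, h0, sub_zero] at h1
    have h2 : l2norm m (f - contHom S g.toContinuousMap) ≤ ε :=
      ENNReal.toReal_le_of_le_ofReal hε.le hg
    have h3 : 0 ≤ l2norm m (f - contHom S g.toContinuousMap) := ENNReal.toReal_nonneg
    exact h1.trans (mul_le_mul (le_abs_self C) h2 h3 (abs_nonneg C))
  rw [← norm_le_zero_iff]
  refine le_of_forall_pos_le_add fun ε hε => ?_
  rw [zero_add]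
  -- The summand `1` keeps the denominator positive when `C = 0`.
  refine (key (ε / (|C| + 1)) (by positivity)).trans ?_
  rw [mul_div_assoc', div_le_iff₀ (by positivity)]
  nlinarith [abs_nonneg C]

end BoundedMeasurable

/-! ### The joint distribution of a trace vector. -/

section JointMeasure

variable {K : Type*} [NormedAddCommGroup K] [InnerProductSpace ℂ K] [CompleteSpace K]
variable {Z W : Type*} [MeasurableSpace Z] [MeasurableSpace W]

/-- The vector state of `ξ` restricts to integration against `m` on both representations. -/
def IsTraceVector (m : Measure Z) (L R : boundedMeasurable Z →⋆ₐ[ℂ] (K →L[ℂ] K)) (ξ : K) : Prop :=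
  ∀ f, inner ℂ ξ (L f ξ) = ∫ z, f.1 z ∂m ∧ inner ℂ ξ (R f ξ) = ∫ z, f.1 z ∂m

/-- `‖L f ξ‖²` is the vector state of `f* f`. Thus `ξ` sees `f` only through its `L²`-class, which
permits density arguments. -/
theorem norm_apply_eq_l2norm {m : Measure Z} [IsFiniteMeasure m]
    (L : boundedMeasurable Z →⋆ₐ[ℂ] (K →L[ℂ] K)) {ξ : K}
    (h : ∀ f, inner ℂ ξ (L f ξ) = ∫ z, f.1 z ∂m) (f : boundedMeasurable Z) :
    ‖L f ξ‖ = l2norm m f := by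
  have h1 := h (star f * f)
  rw [map_mul, map_star, ContinuousLinearMap.star_eq_adjoint, mul_apply_eq_comp,
    ContinuousLinearMap.adjoint_inner_right, inner_self_eq_norm_sq_to_K] at h1
  have h2 : ∫ z, (star f * f).1 z ∂m = ((∫ z, ‖f.1 z‖ ^ 2 ∂m : ℝ) : ℂ) := by
    rw [← integral_complex_ofReal]
    refine integral_congr_ae (Eventually.of_forall fun z => ?_)
    change (starRingEnd ℂ) (f.1 z) * f.1 z = _
    rw [Complex.conj_mul']
    simp
  rw [h2, ← l2norm_sq] at h1
  have h3 : ‖L f ξ‖ ^ 2 = l2norm m f ^ 2 := 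
    Complex.ofReal_injective (by rw [Complex.ofReal_pow]; exact h1)
  exact (pow_left_inj₀ (norm_nonneg _) ENNReal.toReal_nonneg two_ne_zero).1 h3

/-- Move `L f` to the other slot as `L f*` and apply Cauchy–Schwarz. The vector `η` is arbitrary
because it will be `R g ξ`. -/
theorem norm_inner_apply_le {m : Measure Z} [IsFiniteMeasure m]
    {L : boundedMeasurable Z →⋆ₐ[ℂ] (K →L[ℂ] K)} (ξ η : K)
    (h : ∀ f, inner ℂ ξ (L f ξ) = ∫ z, f.1 z ∂m) (f : boundedMeasurable Z) :
    ‖inner ℂ ξ (L f η)‖ ≤ ‖η‖ * l2norm m f := by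
  have e : l2norm m (star f) = l2norm m f := by
    have := l2norm_sq m (star f)
    rw [show ∫ z, ‖(star f).1 z‖ ^ 2 ∂m = ∫ z, ‖f.1 z‖ ^ 2 ∂m from
      integral_congr_ae (Eventually.of_forall fun z => by
        change ‖star (f.1 z)‖ ^ 2 = _
        simp), ← l2norm_sq] at this
    exact (pow_left_inj₀ ENNReal.toReal_nonneg ENNReal.toReal_nonneg two_ne_zero).1 this
  rw [← ContinuousLinearMap.adjoint_inner_left, ← ContinuousLinearMap.star_eq_adjoint, ← map_star,
    mul_comm, ← e, ← norm_apply_eq_l2norm L h]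
  exact norm_inner_le_norm _ _

/-- The integral of a product function, the first factor being bounded in `L²`. -/
theorem norm_integral_mul_le {V : Type*} [MeasurableSpace V] {m : Measure V} {m₁ : Measure Z}
    [IsProbabilityMeasure m₁] {p : V → Z} (hp : MeasurePreserving p m m₁) (f : boundedMeasurable Z)
    {h : V → ℂ} {C : ℝ} (hC : ∀ v, ‖h v‖ ≤ C) :
    ‖∫ v, f.1 (p v) * h v ∂m‖ ≤ |C| * l2norm m₁ f := by
  have hi : Integrable (fun v => ‖f.1 (p v)‖) m :=
    (hp.integrable_comp_of_integrable (integrable_boundedMeasurable f m₁)).norm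
  refine (norm_integral_le_of_norm_le (hi.const_mul |C|) (Eventually.of_forall fun v => ?_)).trans ?_
  · rw [norm_mul, mul_comm]
    exact mul_le_mul_of_nonneg_right ((hC v).trans (le_abs_self C)) (norm_nonneg _)
  · rw [integral_const_mul,
      ← integral_map (φ := p) (f := fun z => ‖f.1 z‖) hp.measurable.aemeasurable
      (by rw [hp.map_eq]; exact (integrable_boundedMeasurable f m₁).norm.1), hp.map_eq]
    exact mul_le_mul_of_nonneg_left (integral_norm_le_l2norm m₁ f) (abs_nonneg C)

/-- Joint calculus and Riesz–Markov give a measure for every vector, with the product formula for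
continuous functions. For a trace vector both sides of the formula are `L²(μ)`-bounded in each
factor, so it extends to measurable functions by density, one factor at a time. The choice `m` is
made for all vectors at once so that two of them can be compared. -/
theorem exists_jointMeasure_unitInterval
    (L R : boundedMeasurable unitInterval →⋆ₐ[ℂ] (K →L[ℂ] K)) (hLR : ∀ f g, Commute (L f) (R g))
    (μ : Measure unitInterval) [IsProbabilityMeasure μ] :
    ∃ m : K → Measure (unitInterval × unitInterval), (∀ ξ, IsTraceVector μ L R ξ →
        IsProbabilityMeasure (m ξ) ∧ (m ξ).map Prod.fst = μ ∧ (m ξ).map Prod.snd = μ ∧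
        ∀ f g, ∫ p, f.1 p.1 * g.1 p.2 ∂(m ξ) = inner ℂ ξ (L f (R g ξ))) ∧
      ∀ ξ η, ‖ξ‖ = 1 → ‖η‖ = 1 → measureDist (m ξ) (m η) ≤ 2 * ‖ξ - η‖ := by
  obtain ⟨Θ, hΘ1, hΘ2⟩ := exists_joint_starAlgHom (L.comp (contHom unitInterval))
    (R.comp (contHom unitInterval)) fun f g => hLR _ _
  choose m hm1 hm2 using exists_spectralMeasure Θ
  refine ⟨m, fun ξ hξ => ?_, fun ξ η hξ hη => ?_⟩
  swap
  · refine measureDist_le_of_continuous _ _ (by positivity) fun f hf => ?_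
    rw [hm2, hm2]
    exact norm_inner_sub_inner_le Θ f hf hξ hη
  have hmarg : ∀ p : unitInterval × unitInterval → unitInterval, Continuous p →
      (∀ g : C(unitInterval, ℂ), ∫ s, g (p s) ∂(m ξ) = ∫ t, g t ∂μ) → (m ξ).map p = μ := by
    intro p hp h
    refine ext_of_forall_integral_eq_of_IsFiniteMeasure fun f => ?_
    rw [integral_map hp.measurable.aemeasurable f.continuous.measurable.aestronglyMeasurable]
    have := h (ofRealCont f.toContinuousMap)
    simp only [ofRealCont, ContinuousMap.coe_mk, integral_complex_ofReal] at this
    exact Complex.ofReal_injective this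
  have h1 : (m ξ).map Prod.fst = μ := hmarg _ continuous_fst fun g => by
    have := hm2 ξ (g.comp ContinuousMap.fst)
    rw [hΘ1] at this
    exact this.trans (hξ (contHom _ g)).1
  have h2 : (m ξ).map Prod.snd = μ := hmarg _ continuous_snd fun g => by
    have := hm2 ξ (g.comp ContinuousMap.snd)
    rw [hΘ2] at this
    exact this.trans (hξ (contHom _ g)).2
  have hmp1 : MeasurePreserving Prod.fst (m ξ) μ := ⟨measurable_fst, h1⟩
  have hmp2 : MeasurePreserving Prod.snd (m ξ) μ := ⟨measurable_snd, h2⟩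
  have hprob : IsProbabilityMeasure (m ξ) := by
    refine ⟨?_⟩
    rw [← Set.preimage_univ (f := Prod.fst), ← Measure.map_apply measurable_fst MeasurableSet.univ,
      h1, measure_univ]
  refine ⟨hprob, h1, h2, ?_⟩
  have hint : ∀ f g : boundedMeasurable unitInterval, Integrable (fun p => f.1 p.1 * g.1 p.2) (m ξ) :=
    fun f g => integrable_boundedMeasurable (compHom _ measurable_fst f * compHom _ measurable_snd g) (m ξ)
  -- both factors continuous
  have c0 : ∀ f g : C(unitInterval, ℂ), ∫ p, (contHom _ f).1 p.1 * (contHom _ g).1 p.2 ∂(m ξ) =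
      inner ℂ ξ (L (contHom _ f) (R (contHom _ g) ξ)) := by
    intro f g
    have := hm2 ξ (f.comp ContinuousMap.fst * g.comp ContinuousMap.snd)
    rw [map_mul, hΘ1, hΘ2] at this
    exact this
  -- the second factor continuous
  have c1 : ∀ (g : C(unitInterval, ℂ)) (f : boundedMeasurable unitInterval),
      ∫ p, f.1 p.1 * (contHom _ g).1 p.2 ∂(m ξ) = inner ℂ ξ (L f (R (contHom _ g) ξ)) := by
    intro g f
    obtain ⟨C, hC⟩ := (contHom _ g).2.2
    refine sub_eq_zero.1 (eq_zero_of_continuous μ (fun f => ∫ p, f.1 p.1 * (contHom _ g).1 p.2 ∂(m ξ)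
      - inner ℂ ξ (L f (R (contHom _ g) ξ))) (fun f f' => ?_) (|C| + ‖R (contHom _ g) ξ‖)
      (fun f => ?_) (fun f => sub_eq_zero.2 (c0 f g)) f)
    · have : (fun p : unitInterval × unitInterval => (f - f').1 p.1 * (contHom _ g).1 p.2) =
        fun p => f.1 p.1 * (contHom _ g).1 p.2 - f'.1 p.1 * (contHom _ g).1 p.2 :=
        funext fun p => sub_mul _ _ _
      simp only [this]
      rw [integral_sub (hint _ _) (hint _ _), map_sub, sub_apply, inner_sub_right]
      ring
    · refine (norm_sub_le _ _).trans ?_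
      rw [add_mul]
      exact add_le_add (norm_integral_mul_le hmp1 f (h := fun p => (contHom _ g).1 p.2)
        fun p => hC p.2) (norm_inner_apply_le ξ _ (fun f => (hξ f).1) f)
  intro f g
  obtain ⟨C, hC⟩ := f.2.2
  refine sub_eq_zero.1 (eq_zero_of_continuous μ (fun g => ∫ p, f.1 p.1 * g.1 p.2 ∂(m ξ)
      - inner ℂ ξ (L f (R g ξ))) (fun g g' => ?_) (|C| + ‖L f‖ * ‖ξ‖)
      (fun g => ?_) (fun g => sub_eq_zero.2 (c1 g f)) g)
  · have : (fun p : unitInterval × unitInterval => f.1 p.1 * (g - g').1 p.2) =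
      fun p => f.1 p.1 * g.1 p.2 - f.1 p.1 * g'.1 p.2 :=
      funext fun p => mul_sub _ _ _
    simp only [this]
    rw [integral_sub (hint _ _) (hint _ _), map_sub, sub_apply, map_sub, inner_sub_right]
    ring
  · refine (norm_sub_le _ _).trans ?_
    rw [add_mul]
    refine add_le_add ?_ ?_
    · have := norm_integral_mul_le hmp2 g (h := fun p => f.1 p.1) fun p => hC p.1
      simpa only [mul_comm] using this
    · refine (norm_inner_le_norm _ _).trans ?_
      rw [← norm_apply_eq_l2norm R (fun f => (hξ f).2) g, mul_assoc, mul_left_comm]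
      exact mul_le_mul_of_nonneg_left ((L f).le_opNorm _) (norm_nonneg _)

/-- The joint distribution of a trace vector for two commuting representations of the bounded
measurable functions on a standard Borel space. -/
theorem exists_jointMeasure [StandardBorelSpace Z] [Nonempty Z]
    (L R : boundedMeasurable Z →⋆ₐ[ℂ] (K →L[ℂ] K)) (hLR : ∀ f g, Commute (L f) (R g))
    (μ : Measure Z) [IsProbabilityMeasure μ] :
    ∃ m : K → Measure (Z × Z), (∀ ξ, IsTraceVector μ L R ξ →
        IsProbabilityMeasure (m ξ) ∧ (m ξ).map Prod.fst = μ ∧ (m ξ).map Prod.snd = μ ∧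
        ∀ f g, ∫ p, f.1 p.1 * g.1 p.2 ∂(m ξ) = inner ℂ ξ (L f (R g ξ))) ∧
      ∀ ξ η, IsTraceVector μ L R ξ → IsTraceVector μ L R η → ‖ξ‖ = 1 → ‖η‖ = 1 →
        measureDist (m ξ) (m η) ≤ 2 * ‖ξ - η‖ := by
  have hJ := measurableEmbedding_sigmoid_comp_embeddingReal Z
  set J := unitInterval.sigmoid ∘ embeddingReal Z
  -- A measurable left inverse of the embedding `J`: the representations are moved to `[0, 1]` along
  -- `J`, and the measures on the square are brought back along `r`.
  obtain ⟨r, hr, hrJ⟩ := hJ.exists_measurable_extend measurable_id fun _ => inferInstance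
  have hrJ' : ∀ z, r (J z) = z := fun z => congrFun hrJ z
  have hμ : IsProbabilityMeasure (μ.map J) :=
    Measure.isProbabilityMeasure_map hJ.measurable.aemeasurable
  obtain ⟨m, hm1, hm2⟩ := exists_jointMeasure_unitInterval (L.comp (compHom J hJ.measurable))
    (R.comp (compHom J hJ.measurable)) (fun f g => hLR _ _) (μ.map J)
  have htr : ∀ ξ, IsTraceVector μ L R ξ → IsTraceVector (μ.map J)
      (L.comp (compHom J hJ.measurable)) (R.comp (compHom J hJ.measurable)) ξ := by
    intro ξ hξ f
    rw [integral_map hJ.measurable.aemeasurable f.2.1.aestronglyMeasurable]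
    exact hξ (compHom J hJ.measurable f)
  have hrr : Measurable (Prod.map r r) := hr.prodMap hr
  have hmap : (μ.map J).map r = μ := by
    rw [Measure.map_map hr hJ.measurable, hrJ, Measure.map_id]
  refine ⟨fun ξ => (m ξ).map (Prod.map r r), fun ξ hξ => ?_, fun ξ η hξ hη nξ nη => ?_⟩
  · obtain ⟨h0, h1, h2, h3⟩ := hm1 ξ (htr ξ hξ)
    refine ⟨Measure.isProbabilityMeasure_map hrr.aemeasurable, ?_, ?_, fun f g => ?_⟩
    · rw [Measure.map_map measurable_fst hrr, ← hmap, ← h1, Measure.map_map hr measurable_fst]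
      rfl
    · rw [Measure.map_map measurable_snd hrr, ← hmap, ← h2, Measure.map_map hr measurable_snd]
      rfl
    · refine (integral_map hrr.aemeasurable
        ((f.2.1.comp measurable_fst).mul (g.2.1.comp measurable_snd)).aestronglyMeasurable).trans ?_
      have e : ∀ f, compHom J hJ.measurable (compHom r hr f) = f := fun f =>
        Subtype.ext (funext fun z => congrArg f.1 (hrJ' z))
      have := h3 (compHom r hr f) (compHom r hr g)
      simp only [StarAlgHom.comp_apply, e] at this
      exact this
  · have := (hm1 ξ (htr ξ hξ)).1
    have := (hm1 η (htr η hη)).1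
    exact (measureDist_map_le _ _ hrr).trans (hm2 ξ η nξ nη)

end JointMeasure

/-! ### Commutators as deviation from the diagonal. -/

section Diagonal

variable {K : Type*} [NormedAddCommGroup K] [InnerProductSpace ℂ K] [CompleteSpace K]
variable {Z : Type*} [MeasurableSpace Z]

/-- The commutator norm of a trace vector in terms of its joint distribution. -/
theorem norm_sub_sq_eq_integral {L R : boundedMeasurable Z →⋆ₐ[ℂ] (K →L[ℂ] K)}
    {μ : Measure Z} [IsProbabilityMeasure μ] {ξ : K} (hξ : IsTraceVector μ L R ξ)
    {m : Measure (Z × Z)} [IsProbabilityMeasure m] (h1 : m.map Prod.fst = μ)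
    (h2 : m.map Prod.snd = μ)
    (hm : ∀ f g : boundedMeasurable Z, ∫ p, f.1 p.1 * g.1 p.2 ∂m = inner ℂ ξ (L f (R g ξ)))
    (f : boundedMeasurable Z) :
    ‖L f ξ - R f ξ‖ ^ 2 = ∫ p, ‖f.1 p.1 - f.1 p.2‖ ^ 2 ∂m := by
  have hn : Measurable fun z => ‖f.1 z‖ ^ 2 := f.2.1.norm.pow_const 2
  have m1 : ∫ p, ‖f.1 p.1‖ ^ 2 ∂m = ∫ z, ‖f.1 z‖ ^ 2 ∂μ := by
    rw [← h1, integral_map measurable_fst.aemeasurable hn.aestronglyMeasurable]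
  have m2 : ∫ p, ‖f.1 p.2‖ ^ 2 ∂m = ∫ z, ‖f.1 z‖ ^ 2 ∂μ := by
    rw [← h2, integral_map measurable_snd.aemeasurable hn.aestronglyMeasurable]
  have hi : Integrable (fun p : Z × Z => (star f).1 p.1 * f.1 p.2) m :=
    integrable_boundedMeasurable (compHom _ measurable_fst (star f) * compHom _ measurable_snd f) m
  have i1 : Integrable (fun p : Z × Z => ‖f.1 p.1‖ ^ 2) m :=
    (memLp_boundedMeasurable (compHom _ measurable_fst f) 2 m).integrable_norm_pow two_ne_zero
  have i2 : Integrable (fun p : Z × Z => ‖f.1 p.2‖ ^ 2) m :=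
    (memLp_boundedMeasurable (compHom _ measurable_snd f) 2 m).integrable_norm_pow two_ne_zero
  -- The pointwise expansion matches that of `‖L f ξ - R f ξ‖²` term by term, the cross terms by the
  -- product formula.
  have e : ∀ p : Z × Z, ‖f.1 p.1 - f.1 p.2‖ ^ 2 = ‖f.1 p.1‖ ^ 2
      - 2 * RCLike.re ((star f).1 p.1 * f.1 p.2) + ‖f.1 p.2‖ ^ 2 := by
    intro p
    rw [norm_sub_sq (𝕜 := ℂ)]
    congr 3
    rw [RCLike.inner_apply, mul_comm]
    rfl
  have hinner : inner ℂ (L f ξ) (R f ξ) = ∫ p, (star f).1 p.1 * f.1 p.2 ∂m := by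
    rw [hm, map_star, ContinuousLinearMap.star_eq_adjoint,
      ContinuousLinearMap.adjoint_inner_right]
  have s1 := integral_add (i1.sub (hi.re.const_mul 2)) i2
  have s2 := integral_sub i1 (hi.re.const_mul 2)
  simp only [Pi.sub_apply] at s1
  simp only [e]
  rw [norm_sub_sq (𝕜 := ℂ), s1, s2, integral_const_mul, integral_re hi, ← hinner, m1, m2,
    norm_apply_eq_l2norm L (fun f => (hξ f).1), norm_apply_eq_l2norm R (fun f => (hξ f).2),
    l2norm_sq]

/-- Concentration near the diagonal in the sense of a measurable embedding into `[0, 1]` implies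
`∫ |f x - f y| → 0` for every bounded measurable `f`. -/
theorem tendsto_integral_norm_sub {μ : Measure Z} [IsProbabilityMeasure μ] {J : Z → unitInterval}
    (hJ : MeasurableEmbedding J) [Nonempty Z] {σ : ℕ → Measure (Z × Z)}
    (hσ : ∀ n, IsProbabilityMeasure (σ n)) (h1 : ∀ n, (σ n).map Prod.fst = μ)
    (h2 : ∀ n, (σ n).map Prod.snd = μ)
    (hlim : Tendsto (fun n => ∫ p, ((J p.1 : ℝ) - J p.2) ^ 2 ∂(σ n)) atTop (𝓝 0))
    (f : boundedMeasurable Z) :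
    Tendsto (fun n => ∫ p, ‖f.1 p.1 - f.1 p.2‖ ∂(σ n)) atTop (𝓝 0) := by
  obtain ⟨r, hr, hrJ⟩ := hJ.exists_measurable_extend measurable_id fun _ => inferInstance
  have hrJ' : ∀ z, r (J z) = z := fun z => congrFun hrJ z
  have hμ : IsProbabilityMeasure (μ.map J) :=
    Measure.isProbabilityMeasure_map hJ.measurable.aemeasurable
  set h := compHom r hr f
  have hfh : ∀ z, f.1 z = h.1 (J z) := fun z => congrArg f.1 (hrJ' z).symm
  have hJ1 : ∀ p : Z × Z, |(J p.1 : ℝ) - J p.2| ≤ 1 := fun p => by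
    have a := (J p.1).2
    have b := (J p.2).2
    rw [abs_le]
    constructor <;> linarith [a.1, a.2, b.1, b.2]
  have hJi : ∀ n, Integrable (fun p : Z × Z => ((J p.1 : ℝ) - J p.2) ^ 2) (σ n) := by
    intro n
    refine Integrable.of_bound (C := 1) (Measurable.aestronglyMeasurable ?_)
      (Eventually.of_forall fun p => ?_)
    · exact ((measurable_subtype_coe.comp (hJ.measurable.comp measurable_fst)).sub
        (measurable_subtype_coe.comp (hJ.measurable.comp measurable_snd))).pow_const 2
    · rw [norm_pow, Real.norm_eq_abs]
      exact pow_le_one₀ (abs_nonneg _) (hJ1 p)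
  rw [Metric.tendsto_atTop]
  intro ε hε
  -- Since `f = h ∘ J`, it is enough to approximate `h` by a continuous function in `L¹` of the
  -- image of `μ`.
  obtain ⟨g, hg, -⟩ := (memLp_boundedMeasurable h 1 (μ.map J)).exists_boundedContinuous_eLpNorm_sub_le
    ENNReal.one_ne_top (ε := ENNReal.ofReal (ε / 8)) (by simpa using hε)
  set G := contHom unitInterval g.toContinuousMap
  have hG : ∀ t, G.1 t = g t := fun _ => rfl
  have hhg : ∫ t, ‖(h - G).1 t‖ ∂(μ.map J) ≤ ε / 8 := by
    rw [eLpNorm_one_eq_lintegral_enorm] at hg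
    exact (integral_norm_eq_lintegral_enorm (memLp_boundedMeasurable (h - G) 1 _).1).trans_le
      (ENNReal.toReal_le_of_le_ofReal (by positivity) hg)
  have hhg' : ∫ z, ‖(h - G).1 (J z)‖ ∂μ ≤ ε / 8 := by
    rwa [integral_map hJ.measurable.aemeasurable (integrable_boundedMeasurable (h - G) _).norm.1]
      at hhg
  obtain ⟨δ, hδ, hδg⟩ := Metric.uniformContinuous_iff.1
    (CompactSpace.uniformContinuous_of_continuous g.continuous) (ε / 8) (by positivity)
  obtain ⟨C, hC⟩ := G.2.2
  have hC0 : 0 ≤ C := (norm_nonneg _).trans (hC 0)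
  -- The first two terms each depend on one coordinate, so the marginals control them. The last one
  -- bounds the variation of `g`: uniform continuity at distance below `δ`, a Chebyshev-type bound
  -- beyond.
  have hpt : ∀ p : Z × Z, ‖f.1 p.1 - f.1 p.2‖ ≤ ‖(h - G).1 (J p.1)‖ + ‖(h - G).1 (J p.2)‖ +
      (ε / 8 + 2 * C / δ ^ 2 * ((J p.1 : ℝ) - J p.2) ^ 2) := by
    intro p
    have hgp : ‖g (J p.1) - g (J p.2)‖ ≤ ε / 8 + 2 * C / δ ^ 2 * ((J p.1 : ℝ) - J p.2) ^ 2 := by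
      by_cases hd : dist (J p.1) (J p.2) < δ
      · have := (hδg hd).le
        rw [dist_eq_norm] at this
        have h3 : 0 ≤ 2 * C / δ ^ 2 * ((J p.1 : ℝ) - J p.2) ^ 2 := by positivity
        linarith
      · rw [not_lt, Subtype.dist_eq, Real.dist_eq] at hd
        have h3 : ‖g (J p.1) - g (J p.2)‖ ≤ 2 * C := by
          have a := hC (J p.1)
          have b := hC (J p.2)
          have := norm_sub_le (g (J p.1)) (g (J p.2))
          rw [hG] at a b
          linarith
        have h4 : δ ^ 2 ≤ ((J p.1 : ℝ) - J p.2) ^ 2 := by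
          rw [← sq_abs ((J p.1 : ℝ) - J p.2)]
          exact pow_le_pow_left₀ hδ.le hd 2
        have h5 : 2 * C ≤ 2 * C / δ ^ 2 * ((J p.1 : ℝ) - J p.2) ^ 2 := by
          rw [div_mul_eq_mul_div, le_div_iff₀ (by positivity)]
          exact mul_le_mul_of_nonneg_left h4 (by positivity)
        linarith
    have e : f.1 p.1 - f.1 p.2 = (h - G).1 (J p.1) - (h - G).1 (J p.2) +
        (g (J p.1) - g (J p.2)) := by
      rw [hfh, hfh]
      change _ = (h.1 _ - g _) - (h.1 _ - g _) + _
      ring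
    rw [e]
    exact (norm_add_le _ _).trans (add_le_add (norm_sub_le _ _) hgp)
  -- Makes the quadratic term at most `ε / 8`, for a total of at most `ε / 2`; the `1` covers `C =
  -- 0`.
  obtain ⟨N, hN⟩ := Metric.tendsto_atTop.1 hlim (ε / 8 / (2 * C / δ ^ 2 + 1)) (by positivity)
  refine ⟨N, fun n hn => ?_⟩
  have hn' := hN n hn
  have hnn : 0 ≤ ∫ p, ((J p.1 : ℝ) - J p.2) ^ 2 ∂(σ n) := integral_nonneg fun p => sq_nonneg _
  rw [Real.dist_eq, sub_zero, abs_of_nonneg hnn, lt_div_iff₀ (by positivity)] at hn'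
  rw [Real.dist_eq, sub_zero, abs_of_nonneg (integral_nonneg fun p => norm_nonneg _)]
  set D := compHom J hJ.measurable (h - G)
  have hDm : Measurable fun z => ‖D.1 z‖ := D.2.1.norm
  have i1 : Integrable (fun p : Z × Z => ‖(h - G).1 (J p.1)‖) (σ n) :=
    (integrable_boundedMeasurable (compHom _ measurable_fst D) (σ n)).norm
  have i2 : Integrable (fun p : Z × Z => ‖(h - G).1 (J p.2)‖) (σ n) :=
    (integrable_boundedMeasurable (compHom _ measurable_snd D) (σ n)).norm
  have m1 : ∫ p, ‖(h - G).1 (J p.1)‖ ∂(σ n) ≤ ε / 8 := by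
    refine le_of_eq_of_le ?_ hhg'
    rw [← h1 n]
    exact (integral_map measurable_fst.aemeasurable hDm.aestronglyMeasurable).symm
  have m2 : ∫ p, ‖(h - G).1 (J p.2)‖ ∂(σ n) ≤ ε / 8 := by
    refine le_of_eq_of_le ?_ hhg'
    rw [← h2 n]
    exact (integral_map measurable_snd.aemeasurable hDm.aestronglyMeasurable).symm
  have i3 : Integrable (fun p : Z × Z => ε / 8 + 2 * C / δ ^ 2 * ((J p.1 : ℝ) - J p.2) ^ 2) (σ n) :=
    (integrable_const _).add ((hJi n).const_mul _)
  refine (integral_mono_of_nonneg (Eventually.of_forall fun p => norm_nonneg _)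
    ((i1.add i2).add i3) (Eventually.of_forall hpt)).trans_lt ?_
  have e := integral_add (i1.add i2) i3
  have e' := integral_add i1 i2
  have e'' := integral_add (integrable_const (ε / 8)) ((hJi n).const_mul (2 * C / δ ^ 2))
  rw [integral_const_mul, integral_const, probReal_univ, one_smul] at e''
  simp only [Pi.add_apply] at e ⊢
  rw [e, e', e'']
  nlinarith

/-- Replacing `g(y)` by `g(x)` costs at most `sup |f| · ∫ |g(x) - g(y)|`, after which only the first
marginal matters. -/
theorem tendsto_integral_mul {μ : Measure Z} [IsProbabilityMeasure μ] {σ : ℕ → Measure (Z × Z)}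
    (hσ : ∀ n, IsProbabilityMeasure (σ n)) (h1 : ∀ n, (σ n).map Prod.fst = μ)
    (f g : boundedMeasurable Z)
    (hg : Tendsto (fun n => ∫ p, ‖g.1 p.1 - g.1 p.2‖ ∂(σ n)) atTop (𝓝 0)) :
    Tendsto (fun n => ∫ p, f.1 p.1 * g.1 p.2 ∂(σ n)) atTop (𝓝 (∫ z, f.1 z * g.1 z ∂μ)) := by
  obtain ⟨C, hC⟩ := f.2.2
  rw [tendsto_iff_norm_sub_tendsto_zero]
  refine squeeze_zero (fun n => norm_nonneg _) (fun n => ?_) (by simpa using hg.const_mul |C|)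
  have e : ∫ z, f.1 z * g.1 z ∂μ = ∫ p, f.1 p.1 * g.1 p.1 ∂(σ n) := by
    rw [← h1 n]
    exact integral_map measurable_fst.aemeasurable (f.2.1.mul g.2.1).aestronglyMeasurable
  have i1 : Integrable (fun p : Z × Z => f.1 p.1 * g.1 p.2) (σ n) :=
    integrable_boundedMeasurable (compHom _ measurable_fst f * compHom _ measurable_snd g) (σ n)
  have i2 : Integrable (fun p : Z × Z => f.1 p.1 * g.1 p.1) (σ n) :=
    integrable_boundedMeasurable (compHom _ measurable_fst (f * g)) (σ n)
  have i3 : Integrable (fun p : Z × Z => ‖g.1 p.1 - g.1 p.2‖) (σ n) :=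
    ((integrable_boundedMeasurable (compHom _ measurable_fst g) (σ n)).sub
      (integrable_boundedMeasurable (compHom _ measurable_snd g) (σ n))).norm
  rw [e, ← integral_sub i1 i2, ← integral_const_mul]
  refine norm_integral_le_of_norm_le (i3.const_mul _) (Eventually.of_forall fun p => ?_)
  rw [← mul_sub, norm_mul, norm_sub_rev]
  exact mul_le_mul_of_nonneg_right ((hC _).trans (le_abs_self C)) (norm_nonneg _)

end Diagonal

/-! ### Fixed vectors of groups of isometries. -/

section FixedPoint

/-- A vector that a group of isometries moves by at most `ε` is within `ε` of a fixed vector. -/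
theorem exists_fixed_vector {K : Type*} [NormedAddCommGroup K] [InnerProductSpace ℂ K]
    [CompleteSpace K] {G : Type*} [Group G] (U : G →* (K →L[ℂ] K))
    (hU : ∀ g x, ‖U g x‖ = ‖x‖) (ξ : K) {ε : ℝ} (hξ : ∀ g, ‖U g ξ - ξ‖ ≤ ε) :
    ∃ η, (∀ g, U g η = η) ∧ ‖η - ξ‖ ≤ ε := by
  let _ : InnerProductSpace ℝ K := InnerProductSpace.rclikeToReal ℂ K
  set O : Set K := Set.range fun g => U g ξ
  set C : Set K := closedConvexHull ℝ O
  have hsub : O ⊆ C := subset_closedConvexHull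
  have hconv : Convex ℝ C := convex_closedConvexHull
  have hclosed : IsClosed C := isClosed_closedConvexHull
  have hball : C ⊆ Metric.closedBall ξ ε := by
    refine closedConvexHull_min ?_ (convex_closedBall ξ ε) Metric.isClosed_closedBall
    rintro _ ⟨g, rfl⟩
    rw [mem_closedBall_iff_norm]
    exact hξ g
  have hinv : ∀ g, ∀ x ∈ C, U g x ∈ C := by
    intro g
    have : C ⊆ (U g) ⁻¹' C := by
      refine closedConvexHull_min ?_ ?_ (hclosed.preimage (U g).continuous)
      · rintro _ ⟨h, rfl⟩
        refine hsub ⟨g * h, ?_⟩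
        simp only [map_mul, mul_apply_eq_comp]
      · exact hconv.linear_preimage ((U g).restrictScalars ℝ).toLinearMap
    exact this
  -- The element of least norm in the closed convex hull of the orbit. The hull is invariant under
  -- the isometries, so the image of `η` also has least norm and uniqueness makes it fixed.
  obtain ⟨η, hη, hmin⟩ := exists_norm_eq_iInf_of_complete_convex
    (⟨_, hsub ⟨1, rfl⟩⟩ : C.Nonempty) hclosed.isComplete hconv 0
  have huniq : ∀ x ∈ C, ‖x‖ = ‖η‖ → x = η := by
    intro x hx hxη
    -- The variational inequality says `⟨η, x⟩ ≥ ‖η‖²`; with equal norms this forces `‖x - η‖² ≤ 0`.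
    have h := (norm_eq_iInf_iff_real_inner_le_zero hconv hη).1 hmin x hx
    have h2 := norm_sub_sq_real x η
    rw [zero_sub, inner_neg_left, inner_sub_right, real_inner_self_eq_norm_sq] at h
    rw [real_inner_comm, hxη] at h2
    have h3 : ‖x - η‖ ^ 2 ≤ 0 := by linarith
    have h4 : ‖x - η‖ = 0 := by nlinarith [norm_nonneg (x - η)]
    exact sub_eq_zero.1 (norm_eq_zero.1 h4)
  exact ⟨η, fun g => huniq _ (hinv g η hη) (hU g η), mem_closedBall_iff_norm.1 (hball hη)⟩

end FixedPoint

/-! ### Multiplication operators by bounded measurable functions. -/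

section Multiplication

variable {Γ : Type*} [MeasurableSpace Γ] {X : Type*} [MeasurableSpace X] {μ : Measure X}

theorem linftyOp_toLp_apply_ae [IsFiniteMeasure μ] (f : boundedMeasurable X)
    (ξ : CrossedSpace Γ μ) :
    linftyOp Γ (memLp_boundedMeasurable f ∞ μ).toLp ξ =ᵐ[(Measure.count : Measure Γ).prod μ]
      fun z => f.1 z.2 * ξ z := by
  filter_upwards [linftyOp_apply_ae (memLp_boundedMeasurable f ∞ μ).toLp ξ,
    Measure.quasiMeasurePreserving_snd.ae (memLp_boundedMeasurable f ∞ μ).coeFn_toLp] with z h1 h2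
  rw [h1, h2]

/-- An operator acting as multiplication by `f` is the operator of `f`. -/
theorem eq_linftyOp_toLp [IsFiniteMeasure μ] (f : boundedMeasurable X)
    (T : CrossedSpace Γ μ →L[ℂ] CrossedSpace Γ μ)
    (h : ∀ ξ, T ξ =ᵐ[(Measure.count : Measure Γ).prod μ] fun z => f.1 z.2 * ξ z) :
    linftyOp Γ (memLp_boundedMeasurable f ∞ μ).toLp = T := by
  ext1 ξ
  exact Lp.ext ((linftyOp_toLp_apply_ae f ξ).trans (h ξ).symm)

variable (Γ μ)

/-- The representation of the bounded measurable functions on `L²(Γ × X)` by multiplication. -/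
noncomputable def multiplicationHom [IsFiniteMeasure μ] :
    boundedMeasurable X →⋆ₐ[ℂ] (CrossedSpace Γ μ →L[ℂ] CrossedSpace Γ μ) where
  toFun f := linftyOp Γ (memLp_boundedMeasurable f ∞ μ).toLp
  map_one' := eq_linftyOp_toLp _ _ fun ξ => Eventually.of_forall fun z => (one_mul _).symm
  map_mul' f g := eq_linftyOp_toLp _ _ fun ξ => by
    filter_upwards [linftyOp_toLp_apply_ae g ξ, linftyOp_toLp_apply_ae f
      (linftyOp Γ (memLp_boundedMeasurable g ∞ μ).toLp ξ)] with z h1 h2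
    rw [mul_apply_eq_comp, h2, h1]
    exact (mul_assoc _ _ _).symm
  map_zero' := eq_linftyOp_toLp _ _ fun ξ => by
    filter_upwards [Lp.coeFn_zero ℂ 2 ((Measure.count : Measure Γ).prod μ)] with z h
    rw [zero_apply, h]
    exact (zero_mul _).symm
  map_add' f g := eq_linftyOp_toLp _ _ fun ξ => by
    filter_upwards [linftyOp_toLp_apply_ae g ξ, linftyOp_toLp_apply_ae f ξ,
      Lp.coeFn_add (linftyOp Γ (memLp_boundedMeasurable f ∞ μ).toLp ξ)
        (linftyOp Γ (memLp_boundedMeasurable g ∞ μ).toLp ξ)] with z h1 h2 h3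
    rw [add_apply, h3, Pi.add_apply, h1, h2]
    exact (add_mul _ _ _).symm
  commutes' c := eq_linftyOp_toLp _ _ fun ξ => by
    filter_upwards [Lp.coeFn_smul c ξ] with z h
    rw [Algebra.algebraMap_eq_smul_one, smul_apply, one_apply_eq_self, h]
    rfl
  map_star' f := by
    rw [star_linftyOp]
    rfl

variable {Γ μ}

theorem multiplicationHom_apply_ae [IsFiniteMeasure μ] (f : boundedMeasurable X)
    (ξ : CrossedSpace Γ μ) :
    multiplicationHom Γ μ f ξ =ᵐ[(Measure.count : Measure Γ).prod μ] fun z => f.1 z.2 * ξ z :=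
  linftyOp_toLp_apply_ae f ξ

/-- The vacuum vector is `1` on the fibre over `1 ∈ Γ`, so applying the operators to it recovers the
functions. -/
theorem ae_eq_of_multiplicationHom_eq [Group Γ] [Countable Γ] [DiscreteMeasurableSpace Γ]
    [IsFiniteMeasure μ] {f g : boundedMeasurable X}
    (h : multiplicationHom Γ μ f = multiplicationHom Γ μ g) : f.1 =ᵐ[μ] g.1 := by
  have h1 := multiplicationHom_apply_ae f (vacuum Γ μ)
  rw [h] at h1
  have h2 := h1.symm.trans (multiplicationHom_apply_ae g (vacuum Γ μ))
  filter_upwards [ae_fibre.1 h2 1, ae_fibre.1 (vacuum_ae (Γ := Γ) (μ := μ)) 1] with x h3 h4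
  rw [h4] at h3
  simpa using h3

theorem inner_vacuum_multiplicationHom [Group Γ] [Countable Γ] [DiscreteMeasurableSpace Γ]
    [IsFiniteMeasure μ] (f : boundedMeasurable X) :
    inner ℂ (vacuum Γ μ) (multiplicationHom Γ μ f (vacuum Γ μ)) = ∫ x, f.1 x ∂μ := by
  rw [L2.inner_def]
  have e : (fun z => inner ℂ (vacuum Γ μ z) (multiplicationHom Γ μ f (vacuum Γ μ) z))
      =ᵐ[(Measure.count : Measure Γ).prod μ]
      (({1} : Set Γ) ×ˢ (Set.univ : Set X)).indicator fun z => f.1 z.2 := by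
    filter_upwards [vacuum_ae (Γ := Γ) (μ := μ), multiplicationHom_apply_ae f (vacuum Γ μ)]
      with z h1 h2
    rw [h2, h1]
    by_cases h : z.1 = 1 <;> simp [h]
  rw [integral_congr_ae e, integral_indicator ((MeasurableSet.singleton 1).prod MeasurableSet.univ),
    ← (mp_fibre (Γ := Γ) (μ := μ)).map_eq]
  exact integral_map measurable_prodMk_left.aemeasurable
    (f.2.1.comp measurable_snd).aestronglyMeasurable

/-- Cut a measurable representative to zero where it exceeds the essential norm, which happens only
on a null set. -/
theorem exists_boundedMeasurable_ae_eq (F : Lp ℂ ∞ μ) :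
    ∃ f : boundedMeasurable X, f.1 =ᵐ[μ] F := by
  have hF := (Lp.stronglyMeasurable F).measurable
  have hm : MeasurableSet {x | ‖F x‖ ≤ ‖F‖} := measurableSet_le hF.norm measurable_const
  refine ⟨⟨{x | ‖F x‖ ≤ ‖F‖}.indicator F, hF.indicator hm, ‖F‖, fun x => ?_⟩, ?_⟩
  · by_cases hx : ‖F x‖ ≤ ‖F‖
    · rwa [Set.indicator_of_mem (by exact hx)]
    · rw [Set.indicator_of_notMem (by exact hx), norm_zero]
      exact norm_nonneg _
  · have h : ∀ᵐ x ∂μ, ‖F x‖ ≤ ‖F‖ := by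
      have h1 := ae_le_eLpNormEssSup (f := F) (μ := μ)
      rw [← eLpNorm_exponent_top] at h1
      filter_upwards [h1] with x hx
      rw [Lp.norm_def]
      have := ENNReal.toReal_mono (Lp.eLpNorm_ne_top F) hx
      simpa using this
    filter_upwards [h] with x hx
    exact Set.indicator_of_mem (by exact hx) _

/-- The elements of `factorAlgebra` are multiplications by bounded measurable functions of `q`. -/
theorem exists_multiplicationHom_eq_of_mem_factorAlgebra [Group Γ] [Countable Γ]
    [DiscreteMeasurableSpace Γ] [IsFiniteMeasure μ] {Y : Type*} [MeasurableSpace Y]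
    {ν : Measure Y} {q : X → Y} (hq : MeasurePreserving q μ ν)
    {b : CrossedSpace Γ μ →L[ℂ] CrossedSpace Γ μ} (hb : b ∈ factorAlgebra Γ q hq) :
    ∃ k : boundedMeasurable Y, b = multiplicationHom Γ μ (compHom q hq.measurable k) := by
  obtain ⟨F, rfl⟩ := (mem_factorAlgebra_iff hq).1 hb
  obtain ⟨k, hk⟩ := exists_boundedMeasurable_ae_eq F
  refine ⟨k, (eq_linftyOp_toLp _ _ fun ξ => ?_).symm⟩
  filter_upwards [linftyOp_apply_ae (Lp.compMeasurePreserving q hq F) ξ,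
    Measure.quasiMeasurePreserving_snd.ae (Lp.coeFn_compMeasurePreserving F hq),
    Measure.quasiMeasurePreserving_snd.ae (hq.quasiMeasurePreserving.ae hk)] with z h1 h2 h3
  rw [h1, h2, Function.comp_apply, ← h3]
  rfl

end Multiplication

/-! ### Canonical unitaries and the covariance relation. -/

section Crossed

variable {Γ : Type*} [Group Γ] [Countable Γ] [MeasurableSpace Γ] [DiscreteMeasurableSpace Γ]
  {X : Type*} [MeasurableSpace X] {μ : Measure X} [MulAction Γ X] [MeasurableConstSMul Γ X]
  [SMulInvariantMeasure Γ X μ]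

theorem groupOp_apply_ae [SFinite μ] (g : Γ) (ξ : CrossedSpace Γ μ) :
    groupOp g ξ =ᵐ[(Measure.count : Measure Γ).prod μ] fun z => ξ (g⁻¹ • z) :=
  Lp.coeFn_compMeasurePreserving ξ (measurePreserving_diag_smul g⁻¹)

theorem star_groupOp_mul_self [SFinite μ] (g : Γ) :
    star (groupOp (μ := μ) g) * groupOp g = 1 :=
  (ContinuousLinearMap.norm_map_iff_adjoint_comp_self _).1 fun ξ =>
    (Lp.compMeasurePreservingₗᵢ ℂ (fun z : Γ × X => g⁻¹ • z)
      (measurePreserving_diag_smul g⁻¹)).norm_map ξ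

theorem groupOp_mul_groupOp_inv [SFinite μ] (g : Γ) :
    groupOp (μ := μ) g * groupOp g⁻¹ = 1 := by
  ext1 ξ
  apply Lp.ext
  filter_upwards [groupOp_apply_ae g (groupOp g⁻¹ ξ),
    (measurePreserving_diag_smul (μ := μ) g⁻¹).quasiMeasurePreserving.ae (groupOp_apply_ae g⁻¹ ξ)]
    with z h1 h2
  rw [mul_apply_eq_comp, h1, h2, inv_inv, smul_inv_smul, one_apply_eq_self]

/-- The adjoint is a left inverse and `groupOp g⁻¹` a right inverse, so the two coincide. -/
theorem groupOp_mul_star_self [SFinite μ] (g : Γ) :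
    groupOp (μ := μ) g * star (groupOp g) = 1 := by
  have h : star (groupOp (μ := μ) g) = groupOp g⁻¹ :=
    left_inv_eq_right_inv (star_groupOp_mul_self g) (groupOp_mul_groupOp_inv g)
  rw [h, groupOp_mul_groupOp_inv]

/-- The covariance relation, through which conjugating a vector will translate its joint
distribution. -/
theorem groupOp_mul_multiplicationHom [IsFiniteMeasure μ] (g : Γ) (f : boundedMeasurable X) :
    groupOp g * multiplicationHom Γ μ f =
      multiplicationHom Γ μ (compHom _ (measurable_const_smul g⁻¹) f) * groupOp g := by
  ext1 ξ
  apply Lp.ext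
  filter_upwards [groupOp_apply_ae g (multiplicationHom Γ μ f ξ), groupOp_apply_ae g ξ,
    multiplicationHom_apply_ae (compHom _ (measurable_const_smul g⁻¹) f) (groupOp g ξ),
    (measurePreserving_diag_smul (μ := μ) g⁻¹).quasiMeasurePreserving.ae
      (multiplicationHom_apply_ae f ξ)] with z h1 h2 h3 h4
  rw [mul_apply_eq_comp, mul_apply_eq_comp, h1, h3, h4, h2]
  rfl

variable (Γ μ)

/-- The bounded measurable functions as elements of the crossed product. -/
noncomputable def crossedMul [IsFiniteMeasure μ] :
    boundedMeasurable X →⋆ₐ[ℂ] (crossedProduct Γ μ).toStarSubalgebra :=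
  (multiplicationHom Γ μ).codRestrict _ fun _ => subset_generatedBy (Or.inl ⟨_, rfl⟩)

variable {Γ}

/-- The canonical unitaries as elements of the crossed product. -/
noncomputable def crossedUnit [SFinite μ] (g : Γ) : (crossedProduct Γ μ).toStarSubalgebra :=
  ⟨groupOp g, subset_generatedBy (Or.inr ⟨g, rfl⟩)⟩

variable {μ}

theorem crossedTrace_crossedMul [IsFiniteMeasure μ] (f : boundedMeasurable X) :
    crossedTrace Γ μ (crossedMul Γ μ f) = ∫ x, f.1 x ∂μ :=
  inner_vacuum_multiplicationHom f

theorem star_crossedUnit_mul_self [SFinite μ] (g : Γ) :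
    star (crossedUnit μ g) * crossedUnit μ g = 1 :=
  Subtype.ext (star_groupOp_mul_self g)

theorem crossedUnit_mul_star_self [SFinite μ] (g : Γ) :
    crossedUnit μ g * star (crossedUnit μ g) = 1 :=
  Subtype.ext (groupOp_mul_star_self g)

theorem crossedUnit_mul_crossedMul_mul_star [IsFiniteMeasure μ] (g : Γ)
    (f : boundedMeasurable X) : crossedUnit μ g * crossedMul Γ μ f * star (crossedUnit μ g) =
      crossedMul Γ μ (compHom _ (measurable_const_smul g⁻¹) f) := by
  have h : crossedUnit μ g * crossedMul Γ μ f =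
      crossedMul Γ μ (compHom _ (measurable_const_smul g⁻¹) f) * crossedUnit μ g :=
    Subtype.ext (groupOp_mul_multiplicationHom g f)
  rw [h, mul_assoc, crossedUnit_mul_star_self, mul_one]

end Crossed

/-- Commutants are norm closed. Hence a von Neumann algebra is a C⋆-algebra and is spanned by its
unitaries. -/
theorem isClosed_vonNeumannAlgebra {H : Type*} [NormedAddCommGroup H] [InnerProductSpace ℂ H]
    [CompleteSpace H] (B : VonNeumannAlgebra H) :
    IsClosed (B.toStarSubalgebra : Set (H →L[ℂ] H)) := by
  have h := B.centralizer_centralizer'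
  change Set.centralizer (Set.centralizer (B.toStarSubalgebra : Set (H →L[ℂ] H))) =
    (B.toStarSubalgebra : Set (H →L[ℂ] H)) at h
  rw [← h]
  exact Set.isClosed_centralizer _

/-- Joint distributions on `Z × Z` are determined by the integrals of products. -/
theorem measure_ext_of_integral_mul {Z : Type*} [MeasurableSpace Z] {m m' : Measure (Z × Z)}
    [IsFiniteMeasure m] [IsFiniteMeasure m']
    (h : ∀ f g : boundedMeasurable Z, ∫ p, f.1 p.1 * g.1 p.2 ∂m = ∫ p, f.1 p.1 * g.1 p.2 ∂m') :
    m = m' := by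
  classical
  refine Measure.ext_prod fun {s t} hs ht => ?_
  have ind : ∀ s : Set Z, MeasurableSet s →
      s.indicator (fun _ => (1 : ℂ)) ∈ boundedMeasurable Z := fun s hs =>
    ⟨measurable_const.indicator hs, 1, fun z => by by_cases hz : z ∈ s <;> simp [hz]⟩
  have e : ∀ p : Z × Z, s.indicator (fun _ => (1 : ℂ)) p.1 * t.indicator (fun _ => (1 : ℂ)) p.2 =
      (s ×ˢ t).indicator (fun _ => (1 : ℂ)) p := by
    intro p
    by_cases h1 : p.1 ∈ s <;> by_cases h2 : p.2 ∈ t <;> simp [h1, h2]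
  have := h ⟨_, ind s hs⟩ ⟨_, ind t ht⟩
  simp only [e, integral_indicator_const _ (hs.prod ht), Complex.real_smul, mul_one,
    Complex.ofReal_inj] at this
  exact (measureReal_eq_measureReal_iff).1 this

/-! ### Conjugation by unitaries and central vectors in a bimodule. -/

namespace HilbertBimodule

variable {H : Type*} [NormedAddCommGroup H] [InnerProductSpace ℂ H] [CompleteSpace H]
  {M : VonNeumannAlgebra H} {K : Type*} [NormedAddCommGroup K] [InnerProductSpace ℂ K]
  [CompleteSpace K]

theorem right_op_mul (𝓗 : HilbertBimodule M K) (x y : M.toStarSubalgebra) :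
    𝓗.right (MulOpposite.op (x * y)) =
      𝓗.right (MulOpposite.op y) * 𝓗.right (MulOpposite.op x) := by
  rw [MulOpposite.op_mul, map_mul]

theorem right_op_star (𝓗 : HilbertBimodule M K) (x : M.toStarSubalgebra) :
    𝓗.right (MulOpposite.op (star x)) = star (𝓗.right (MulOpposite.op x)) := by
  rw [MulOpposite.op_star, map_star]

theorem norm_left_of_isometry (𝓗 : HilbertBimodule M K) {u : M.toStarSubalgebra}
    (hu : star u * u = 1) (ξ : K) : ‖𝓗.left u ξ‖ = ‖ξ‖ :=
  (ContinuousLinearMap.norm_map_iff_adjoint_comp_self (𝓗.left u)).2 (by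
    have := congrArg 𝓗.left hu
    rwa [map_mul, map_star, map_one] at this) ξ

theorem norm_right_of_coisometry (𝓗 : HilbertBimodule M K) {u : M.toStarSubalgebra}
    (hu : u * star u = 1) (ξ : K) : ‖𝓗.right (MulOpposite.op u) ξ‖ = ‖ξ‖ :=
  (ContinuousLinearMap.norm_map_iff_adjoint_comp_self (𝓗.right (MulOpposite.op u))).2 (by
    have := congrArg (fun x => 𝓗.right (MulOpposite.op x)) hu
    simp only [right_op_mul, right_op_star, MulOpposite.op_one, map_one] at this
    exact this) ξ

theorem left_right_comm (𝓗 : HilbertBimodule M K) (x y : M.toStarSubalgebra) (ξ : K) :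
    𝓗.left x (𝓗.right (MulOpposite.op y) ξ) = 𝓗.right (MulOpposite.op y) (𝓗.left x ξ) :=
  DFunLike.congr_fun (𝓗.commute x (MulOpposite.op y)) ξ

theorem inner_left_star (𝓗 : HilbertBimodule M K) (x : M.toStarSubalgebra) (ξ η : K) :
    inner ℂ (𝓗.left (star x) ξ) η = inner ℂ ξ (𝓗.left x η) := by
  rw [map_star, ContinuousLinearMap.star_eq_adjoint, ContinuousLinearMap.adjoint_inner_left]

theorem inner_right (𝓗 : HilbertBimodule M K) (x : M.toStarSubalgebra) (ξ η : K) :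
    inner ℂ (𝓗.right (MulOpposite.op x) ξ) η =
      inner ℂ ξ (𝓗.right (MulOpposite.op (star x)) η) := by
  rw [right_op_star, ContinuousLinearMap.star_eq_adjoint, ContinuousLinearMap.adjoint_inner_right]

/-- The displacement of `ξ` under conjugation by a unitary. -/
theorem norm_conj_sub (𝓗 : HilbertBimodule M K) {u : M.toStarSubalgebra}
    (h1 : star u * u = 1) (h2 : u * star u = 1) (ξ : K) :
    ‖𝓗.left u (𝓗.right (MulOpposite.op (star u)) ξ) - ξ‖ = ‖𝓗.lact u ξ - 𝓗.ract ξ u‖ := by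
  have e : ξ = 𝓗.right (MulOpposite.op (star u)) (𝓗.right (MulOpposite.op u) ξ) := by
    rw [← mul_apply_eq_comp, ← right_op_mul, h2, MulOpposite.op_one, map_one, one_apply_eq_self]
  have e2 : 𝓗.left u (𝓗.right (MulOpposite.op (star u)) ξ) - ξ =
      𝓗.right (MulOpposite.op (star u)) (𝓗.lact u ξ - 𝓗.ract ξ u) := by
    rw [map_sub, left_right_comm, lact, ract, ← e]
  rw [e2, norm_right_of_coisometry 𝓗 (by rwa [star_star])]

/-- A vector almost commuting with the unitaries of `B` is close to a `B`-central vector. -/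
theorem exists_isCentral (𝓗 : HilbertBimodule M K) {B : VonNeumannAlgebra H} (hBM : B ≤ M)
    (ξ : K) {ε : ℝ} (h : ∀ b : M.toStarSubalgebra, (b : H →L[ℂ] H) ∈ B → star b * b = 1 →
      b * star b = 1 → ‖𝓗.lact b ξ - 𝓗.ract ξ b‖ ≤ ε) :
    ∃ η, 𝓗.IsCentral B η ∧ ‖η - ξ‖ ≤ ε := by
  have hcl : IsClosed (B.toStarSubalgebra : Set (H →L[ℂ] H)) := isClosed_vonNeumannAlgebra B
  have hle : B.toStarSubalgebra ≤ M.toStarSubalgebra := hBM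
  let ι : B.toStarSubalgebra →⋆ₐ[ℂ] M.toStarSubalgebra := StarSubalgebra.inclusion hle
  have hu1 : ∀ b : unitary B.toStarSubalgebra, star (ι b) * ι b = 1 := fun b => by
    rw [← map_star, ← map_mul, Unitary.star_mul_self_of_mem b.2, map_one]
  have hu2 : ∀ b : unitary B.toStarSubalgebra, ι b * star (ι b) = 1 := fun b => by
    rw [← map_star, ← map_mul, Unitary.mul_star_self_of_mem b.2, map_one]
  -- Conjugation `x ↦ b x b*`. It is multiplicative because the right action and the adjoint both
  -- reverse products.
  let U : unitary B.toStarSubalgebra →* (K →L[ℂ] K) :=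
    { toFun := fun b => 𝓗.left (ι b) * 𝓗.right (MulOpposite.op (star (ι b)))
      map_one' := by
        rw [OneMemClass.coe_one, map_one, star_one, map_one, MulOpposite.op_one, map_one, mul_one]
      map_mul' := fun a b => by
        rw [Submonoid.coe_mul, map_mul, star_mul, map_mul, right_op_mul, mul_assoc, mul_assoc,
          ← mul_assoc (𝓗.left (ι b)), (𝓗.commute (ι b) _).eq, mul_assoc] }
  have hUa : ∀ b x, U b x = 𝓗.left (ι b) (𝓗.right (MulOpposite.op (star (ι b))) x) :=
    fun b x => rfl
  obtain ⟨η, hη, hηξ⟩ := exists_fixed_vector U (fun b x => by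
    rw [hUa, norm_left_of_isometry 𝓗 (hu1 b),
      norm_right_of_coisometry 𝓗 (by rw [star_star]; exact hu1 b)]) ξ (ε := ε) (fun b => by
    rw [hUa, norm_conj_sub 𝓗 (hu1 b) (hu2 b)]
    exact h _ b.1.2 (hu1 b) (hu2 b))
  refine ⟨η, fun b hb => ?_, hηξ⟩
  -- Commuting with `η` is a linear condition on `b`, so it passes from the unitaries to their span,
  -- which is all of `B`.
  let N : Submodule ℂ B.toStarSubalgebra :=
    { carrier := {b | 𝓗.left (ι b) η = 𝓗.right (MulOpposite.op (ι b)) η}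
      add_mem' := fun {a b} ha hb => by
        simp only [Set.mem_ofPred_eq] at ha hb ⊢
        rw [map_add, map_add, MulOpposite.op_add, map_add, add_apply, add_apply, ha, hb]
      zero_mem' := by
        simp only [Set.mem_ofPred_eq]
        rw [map_zero, map_zero, MulOpposite.op_zero, map_zero]
      smul_mem' := fun c a ha => by
        simp only [Set.mem_ofPred_eq] at ha ⊢
        rw [map_smul, map_smul, MulOpposite.op_smul, map_smul, smul_apply, smul_apply, ha] }
  have hN : Submodule.span ℂ (unitary B.toStarSubalgebra : Set B.toStarSubalgebra) ≤ N := by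
    refine Submodule.span_le.2 fun u hu => ?_
    have e := hη ⟨u, hu⟩
    rw [hUa, left_right_comm] at e
    change 𝓗.left (ι u) η = 𝓗.right (MulOpposite.op (ι u)) η
    conv_rhs => rw [← e]
    rw [← mul_apply_eq_comp, ← right_op_mul, hu1 ⟨u, hu⟩, MulOpposite.op_one, map_one,
      one_apply_eq_self]
  have hspan := CStarAlgebra.span_unitary B.toStarSubalgebra
  have hbN : (⟨b, hb⟩ : B.toStarSubalgebra) ∈ N := hN (hspan ▸ Submodule.mem_top)
  exact hbN

end HilbertBimodule

/-! ### Bimodules over the crossed product: actions of functions and translation. -/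

section CrossedBimodule

variable {Γ : Type*} [Group Γ] [Countable Γ] [MeasurableSpace Γ] [DiscreteMeasurableSpace Γ]
  {X : Type*} [MeasurableSpace X] {μ : Measure X} [MulAction Γ X] [MeasurableConstSMul Γ X]
  [SMulInvariantMeasure Γ X μ] {K : Type*} [NormedAddCommGroup K] [InnerProductSpace ℂ K]
  [CompleteSpace K]

/-- The left action of bounded measurable functions. -/
noncomputable def leftMul [IsFiniteMeasure μ] (𝓗 : HilbertBimodule (crossedProduct Γ μ) K) :
    boundedMeasurable X →⋆ₐ[ℂ] (K →L[ℂ] K) :=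
  𝓗.left.comp (crossedMul Γ μ)

/-- The right action of bounded measurable functions. -/
noncomputable def rightMul [IsFiniteMeasure μ] (𝓗 : HilbertBimodule (crossedProduct Γ μ) K) :
    boundedMeasurable X →⋆ₐ[ℂ] (K →L[ℂ] K) where
  toFun f := 𝓗.right (MulOpposite.op (crossedMul Γ μ f))
  map_one' := by rw [map_one, MulOpposite.op_one, map_one]
  map_mul' f g := by
    -- Commutativity of functions turns the right action, which reverses products, into a
    -- homomorphism.
    have e : f * g = g * f := Subtype.ext (mul_comm f.1 g.1)
    rw [e, map_mul, 𝓗.right_op_mul]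
  map_zero' := by rw [map_zero, MulOpposite.op_zero, map_zero]
  map_add' f g := by rw [map_add, MulOpposite.op_add, map_add]
  commutes' c := by
    rw [AlgHomClass.commutes, Algebra.algebraMap_eq_smul_one, MulOpposite.op_smul, map_smul,
      MulOpposite.op_one, map_one, Algebra.algebraMap_eq_smul_one]
  map_star' f := by rw [map_star, 𝓗.right_op_star]

theorem isTraceVector_of_isTracial [IsFiniteMeasure μ] {𝓗 : HilbertBimodule (crossedProduct Γ μ) K}
    {ξ : K} (hξ : 𝓗.IsTracial (crossedTrace Γ μ) ξ) :
    IsTraceVector μ (leftMul 𝓗) (rightMul 𝓗) ξ := fun f => by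
  rw [← crossedTrace_crossedMul (Γ := Γ) f]
  exact hξ _

/-- Conjugating a vector by a canonical unitary translates its coefficients. -/
theorem inner_conj_crossedUnit [IsFiniteMeasure μ] (𝓗 : HilbertBimodule (crossedProduct Γ μ) K)
    (g : Γ) (ξ : K) (f₁ f₂ : boundedMeasurable X) :
    let ξ' := 𝓗.left (star (crossedUnit μ g)) (𝓗.right (MulOpposite.op (crossedUnit μ g)) ξ)
    inner ℂ ξ' (leftMul 𝓗 f₁ (rightMul 𝓗 f₂ ξ')) =
      inner ℂ ξ (leftMul 𝓗 (compHom _ (measurable_const_smul g⁻¹) f₁)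
        (rightMul 𝓗 (compHom _ (measurable_const_smul g⁻¹) f₂) ξ)) := by
  intro ξ'
  -- Covariance expresses each translated function as a conjugate by `u_g`; the outer unitaries are
  -- then moved to the other slot by taking adjoints, where they form `ξ'`.
  have e1 : leftMul 𝓗 (compHom _ (measurable_const_smul g⁻¹) f₁) = 𝓗.left (crossedUnit μ g) *
      (𝓗.left (crossedMul Γ μ f₁) * 𝓗.left (star (crossedUnit μ g))) := by
    rw [← mul_assoc, ← map_mul, ← map_mul, crossedUnit_mul_crossedMul_mul_star]
    rfl
  have e2 : rightMul 𝓗 (compHom _ (measurable_const_smul g⁻¹) f₂) =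
      𝓗.right (MulOpposite.op (star (crossedUnit μ g))) *
      (𝓗.right (MulOpposite.op (crossedMul Γ μ f₂)) *
        𝓗.right (MulOpposite.op (crossedUnit μ g))) := by
    rw [← 𝓗.right_op_mul, ← 𝓗.right_op_mul, crossedUnit_mul_crossedMul_mul_star]
    rfl
  rw [e1, e2]
  change inner ℂ ξ' (𝓗.left (crossedMul Γ μ f₁) (𝓗.right (MulOpposite.op (crossedMul Γ μ f₂)) ξ')) =
    _
  simp only [ξ', mul_apply_eq_comp, 𝓗.inner_left_star, 𝓗.inner_right]
  simp only [𝓗.left_right_comm]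

end CrossedBimodule

theorem integral_comp_smul {G X : Type*} [Group G] [MeasurableSpace X] [MulAction G X]
    [MeasurableConstSMul G X] {μ : Measure X} [SMulInvariantMeasure G X μ] (g : G)
    (f : boundedMeasurable X) :
    ∫ x, (compHom _ (measurable_const_smul g) f).1 x ∂μ = ∫ x, f.1 x ∂μ :=
  (measurePreserving_smul g μ).integral_comp (measurableEmbedding_const_smul g) f.1

/-! ### From tracial vectors to measures, and from concentration to central vectors. -/

section CrossedBimodule

variable {Γ : Type*} [Group Γ] [Countable Γ] [MeasurableSpace Γ] [DiscreteMeasurableSpace Γ]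
  {X : Type*} [MeasurableSpace X] {μ : Measure X} [MulAction Γ X] [MeasurableConstSMul Γ X]
  [SMulInvariantMeasure Γ X μ] {K : Type*} [NormedAddCommGroup K] [InnerProductSpace ℂ K]
  [CompleteSpace K]

/-- Put one of the two functions equal to `1` in `inner_conj_crossedUnit` and use the invariance of
`μ`. -/
theorem isTraceVector_conj_crossedUnit [IsFiniteMeasure μ]
    {𝓗 : HilbertBimodule (crossedProduct Γ μ) K} {ξ : K}
    (hξ : IsTraceVector μ (leftMul 𝓗) (rightMul 𝓗) ξ) (g : Γ) :
    IsTraceVector μ (leftMul 𝓗) (rightMul 𝓗)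
      (𝓗.left (star (crossedUnit μ g)) (𝓗.right (MulOpposite.op (crossedUnit μ g)) ξ)) := by
  intro f
  have h1 := inner_conj_crossedUnit 𝓗 g ξ f 1
  have h2 := inner_conj_crossedUnit 𝓗 g ξ 1 f
  simp only [map_one, one_apply_eq_self] at h1 h2
  rw [h1, h2, (hξ _).1, (hξ _).2, integral_comp_smul]
  exact ⟨rfl, rfl⟩

theorem IsTraceVector.norm_eq_one {Z : Type*} [MeasurableSpace Z] {m : Measure Z}
    [IsProbabilityMeasure m] {L R : boundedMeasurable Z →⋆ₐ[ℂ] (K →L[ℂ] K)} {ξ : K}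
    (h : IsTraceVector m L R ξ) : ‖ξ‖ = 1 := by
  have h1 := (h 1).1
  rw [map_one, one_apply_eq_self, inner_self_eq_norm_sq_to_K] at h1
  have h2 : ∫ z, (1 : boundedMeasurable Z).1 z ∂m = 1 := by
    change ∫ z, (1 : ℂ) ∂m = 1
    simp
  rw [h2] at h1
  have h3 : ‖ξ‖ ^ 2 = 1 := Complex.ofReal_injective (by
    rw [Complex.ofReal_pow, Complex.ofReal_one]; exact h1)
  exact (pow_eq_one_iff_of_nonneg (norm_nonneg _) two_ne_zero).1 h3

/-- The measure on `X × X` attached to a tracial vector of a bimodule over the crossed product. -/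
theorem exists_measure_of_isTracial [StandardBorelSpace X] [IsProbabilityMeasure μ]
    (𝓗 : HilbertBimodule (crossedProduct Γ μ) K) {ξ : K}
    (hξ : 𝓗.IsTracial (crossedTrace Γ μ) ξ) :
    ∃ m : Measure (X × X), IsProbabilityMeasure m ∧ m.map Prod.fst = μ ∧ m.map Prod.snd = μ ∧
      (∀ f : boundedMeasurable X, ‖𝓗.lact (crossedMul Γ μ f) ξ - 𝓗.ract ξ (crossedMul Γ μ f)‖ ^ 2 =
        ∫ p, ‖f.1 p.1 - f.1 p.2‖ ^ 2 ∂m) ∧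
      ∀ g : Γ, measureDist (m.map fun p => g • p) m ≤
        2 * ‖𝓗.lact (crossedUnit μ g⁻¹) ξ - 𝓗.ract ξ (crossedUnit μ g⁻¹)‖ := by
  have hX : Nonempty X := nonempty_of_isProbabilityMeasure μ
  obtain ⟨m, hm, hdist⟩ := exists_jointMeasure (leftMul 𝓗) (rightMul 𝓗)
    (fun f g => 𝓗.commute _ _) μ
  have hξ' := isTraceVector_of_isTracial hξ
  obtain ⟨h0, h1, h2, h3⟩ := hm ξ hξ'
  refine ⟨m ξ, h0, h1, h2, fun f => norm_sub_sq_eq_integral hξ' h1 h2 h3 f, fun g => ?_⟩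
  -- The inverse is needed because conjugation by `u_g` composes functions with `g⁻¹`, while
  -- push-forward by `g` composes them with `g`.
  set u := crossedUnit μ g⁻¹
  have hη := isTraceVector_conj_crossedUnit hξ' g⁻¹
  set η := 𝓗.left (star u) (𝓗.right (MulOpposite.op u) ξ)
  obtain ⟨k0, -, -, k3⟩ := hm η hη
  have hg : Measurable fun p : X × X => g • p :=
    (measurable_const_smul g).prodMap (measurable_const_smul g)
  have hmap : (m ξ).map (fun p => g • p) = m η := by
    have := Measure.isProbabilityMeasure_map (μ := m ξ) hg.aemeasurable
    refine measure_ext_of_integral_mul fun f₁ f₂ => ?_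
    rw [k3]
    refine (integral_map hg.aemeasurable ((f₁.2.1.comp measurable_fst).mul
      (f₂.2.1.comp measurable_snd)).aestronglyMeasurable).trans ?_
    refine Eq.trans ?_ (inner_conj_crossedUnit 𝓗 g⁻¹ ξ f₁ f₂).symm
    rw [← h3]
    simp only [inv_inv]
    rfl
  rw [hmap]
  refine (hdist η ξ hη hξ' hη.norm_eq_one hξ'.norm_eq_one).trans ?_
  have e := 𝓗.norm_conj_sub (u := star u) (by rw [star_star]; exact crossedUnit_mul_star_self _)
    (by rw [star_star]; exact star_crossedUnit_mul_self _) ξ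
  rw [star_star] at e
  -- The isometry `x ↦ u* x u` carries `ξ - u ξ u*` to `u* ξ u - ξ`, so the two displacements have
  -- equal norm.
  have e2 : ‖𝓗.lact (star u) ξ - 𝓗.ract ξ (star u)‖ = ‖𝓗.lact u ξ - 𝓗.ract ξ u‖ := by
    have a := 𝓗.norm_conj_sub (u := u) (star_crossedUnit_mul_self _)
      (crossedUnit_mul_star_self _) ξ
    have hu : ξ = 𝓗.left (star u) (𝓗.right (MulOpposite.op u)
        (𝓗.left u (𝓗.right (MulOpposite.op (star u)) ξ))) := by
      rw [← 𝓗.left_right_comm, ← mul_apply_eq_comp, ← mul_apply_eq_comp (𝓗.right _),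
        ← 𝓗.right_op_mul, ← map_mul, star_crossedUnit_mul_self, MulOpposite.op_one, map_one,
        map_one]
      rfl
    have hd : η - ξ = 𝓗.left (star u) (𝓗.right (MulOpposite.op u)
        (ξ - 𝓗.left u (𝓗.right (MulOpposite.op (star u)) ξ))) := by
      rw [map_sub, map_sub, ← hu]
    refine e.symm.trans (Eq.trans ?_ a)
    rw [hd, 𝓗.norm_left_of_isometry (by rw [star_star]; exact crossedUnit_mul_star_self _),
      𝓗.norm_right_of_coisometry (crossedUnit_mul_star_self _), norm_sub_rev]
  rw [e, e2]

/-- If the measure of a tracial vector is concentrated on `{q x = q y}`, then the vector is close to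
a central vector. -/
theorem exists_isCentral_of_measure_ge [IsProbabilityMeasure μ]
    {Y : Type*} [MeasurableSpace Y] {ν : Measure Y} {q : X → Y} (hq : MeasurePreserving q μ ν)
    (𝓗 : HilbertBimodule (crossedProduct Γ μ) K) (ξ : K) {m : Measure (X × X)}
    [IsProbabilityMeasure m] (h1 : m.map Prod.fst = μ) (h2 : m.map Prod.snd = μ)
    (h3 : ∀ f : boundedMeasurable X,
      ‖𝓗.lact (crossedMul Γ μ f) ξ - 𝓗.ract ξ (crossedMul Γ μ f)‖ ^ 2 =
        ∫ p, ‖f.1 p.1 - f.1 p.2‖ ^ 2 ∂m) {ε : ℝ} (hε : 0 ≤ ε)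
    (hm : 1 - ENNReal.ofReal (ε ^ 2 / 4) ≤ m {p | q p.1 = q p.2}) :
    ∃ η, 𝓗.IsCentral (factorAlgebra Γ q hq) η ∧ ‖η - ξ‖ ≤ ε := by
  refine 𝓗.exists_isCentral (factorAlgebra_le_crossedProduct hq) ξ fun b hb hb1 _ => ?_
  obtain ⟨k, hk⟩ := exists_multiplicationHom_eq_of_mem_factorAlgebra hq hb
  set f := compHom q hq.measurable k
  have hbf : b = crossedMul Γ μ f := Subtype.ext hk
  have hf1 : ∀ᵐ x ∂μ, ‖f.1 x‖ = 1 := by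
    have e : multiplicationHom Γ μ (star f * f) = multiplicationHom Γ μ 1 := by
      rw [map_mul, map_star, map_one, ← hk]
      exact congrArg Subtype.val hb1
    filter_upwards [ae_eq_of_multiplicationHom_eq e] with x hx
    change (starRingEnd ℂ) (f.1 x) * f.1 x = 1 at hx
    rw [Complex.conj_mul'] at hx
    exact (pow_eq_one_iff_of_nonneg (norm_nonneg _) two_ne_zero).1 (by exact_mod_cast hx)
  rw [hbf]
  refine abs_le_of_sq_le_sq' ?_ hε |>.2
  rw [h3]
  -- The set `{q x = q y}` need not be measurable; it is replaced by this measurable set containing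
  -- it.
  set E : Set (X × X) := {p | f.1 p.1 = f.1 p.2}
  have hE : MeasurableSet E := measurableSet_eq_fun (f.2.1.comp measurable_fst)
    (f.2.1.comp measurable_snd)
  have hqE : {p : X × X | q p.1 = q p.2} ⊆ E := fun p hp => congrArg k.1 hp
  have hEc : m Eᶜ ≤ ENNReal.ofReal (ε ^ 2 / 4) := by
    rw [prob_compl_eq_one_sub hE]
    exact tsub_le_iff_tsub_le.1 (hm.trans (measure_mono hqE))
  have a1 : ∀ᵐ p ∂m, ‖f.1 p.1‖ = 1 :=
    (⟨measurable_fst, h1⟩ : MeasurePreserving Prod.fst m μ).quasiMeasurePreserving.ae hf1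
  have a2 : ∀ᵐ p ∂m, ‖f.1 p.2‖ = 1 :=
    (⟨measurable_snd, h2⟩ : MeasurePreserving Prod.snd m μ).quasiMeasurePreserving.ae hf1
  -- Two numbers of modulus one differ by at most `2`; multiplied by `m Eᶜ ≤ ε² / 4` this gives
  -- `ε²`.
  have hle : ∀ᵐ p ∂m, ‖f.1 p.1 - f.1 p.2‖ ^ 2 ≤ Eᶜ.indicator (fun _ => (4 : ℝ)) p := by
    filter_upwards [a1, a2] with p b1 b2
    by_cases hp : p ∈ E
    · rw [Set.indicator_of_notMem (by simpa using hp), sub_eq_zero.2 (by exact hp)]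
      simp
    · rw [Set.indicator_of_mem (by exact hp)]
      have := norm_sub_le (f.1 p.1) (f.1 p.2)
      rw [b1, b2] at this
      nlinarith [norm_nonneg (f.1 p.1 - f.1 p.2)]
  refine (integral_mono_of_nonneg (Eventually.of_forall fun p => sq_nonneg _)
    ((integrable_const _).indicator hE.compl) hle).trans ?_
  rw [integral_indicator_const _ hE.compl, smul_eq_mul]
  have := ENNReal.toReal_le_of_le_ofReal (by positivity) hEc
  change m.real Eᶜ ≤ _ at this
  linarith

end CrossedBimodule

end RigidInclusion

/-! ### The contradiction with the concentration hypothesis. -/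

theorem proposition2p4
    {Γ : Type u} [Group Γ] [Countable Γ] [MeasurableSpace Γ] [DiscreteMeasurableSpace Γ]
    {X : Type v} [MeasurableSpace X] [StandardBorelSpace X]
    (μ : Measure X) [IsProbabilityMeasure μ]
    [MulAction Γ X] [MeasurableConstSMul Γ X] [SMulInvariantMeasure Γ X μ]
    {Y : Type t} [MeasurableSpace Y] (ν : Measure Y) [IsProbabilityMeasure ν]
    (q : X → Y) (hq : MeasurePreserving q μ ν) (hq_onto : Function.Surjective q)
    (hconc : ∀ σ : ℕ → Measure (X × X), (∀ n, IsProbabilityMeasure (σ n)) →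
      (∀ n, (σ n).map Prod.fst = μ ∧ (σ n).map Prod.snd = μ) →
      (∀ f₁ f₂ : X → ℂ, Measurable f₁ → Measurable f₂ →
        (∃ C : ℝ, ∀ x, ‖f₁ x‖ ≤ C) → (∃ C : ℝ, ∀ x, ‖f₂ x‖ ≤ C) →
        Tendsto (fun n => ∫ p, f₁ p.1 * f₂ p.2 ∂(σ n)) atTop (𝓝 (∫ x, f₁ x * f₂ x ∂μ))) →
      (∀ g : Γ, Tendsto (fun n => measureDist ((σ n).map fun p : X × X => g • p) (σ n))
        atTop (𝓝 0)) →
      Tendsto (fun n => σ n {p : X × X | q p.1 = q p.2}) atTop (𝓝 1)) :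
    IsRigid.{w, max u v} (factorAlgebra Γ q hq) (crossedProduct Γ μ) (crossedTrace Γ μ) := by
  classical
  refine ⟨factorAlgebra_le_crossedProduct hq, fun ε hε => ?_⟩
  by_contra! hcon
  have hX : Nonempty X := nonempty_of_isProbabilityMeasure μ
  have hJ := measurableEmbedding_sigmoid_comp_embeddingReal X
  set J := unitInterval.sigmoid ∘ embeddingReal X
  -- Almost commuting with this single function already forces condition (i), since `J` is a
  -- measurable embedding.
  let j : boundedMeasurable X := compHom J hJ.measurable (contHom _ unitCoord)
  obtain ⟨s, hs⟩ := exists_surjective_nat Γ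
  -- The finite sets exhaust the canonical unitaries along the enumeration `s`; the inverses match
  -- the form of `exists_measure_of_isTracial`.
  let F : ℕ → Finset (crossedProduct Γ μ).toStarSubalgebra := fun n =>
    insert (crossedMul Γ μ j) ((Finset.range n).image fun i => crossedUnit μ (s i)⁻¹)
  have key : ∀ n : ℕ, ∃ m : Measure (X × X), IsProbabilityMeasure m ∧ m.map Prod.fst = μ ∧
      m.map Prod.snd = μ ∧ ∫ p, ((J p.1 : ℝ) - J p.2) ^ 2 ∂m ≤ (1 / ((n : ℝ) + 1)) ^ 2 ∧
      (∀ i < n, measureDist (m.map fun p => s i • p) m ≤ 2 * (1 / ((n : ℝ) + 1))) ∧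
      m {p | q p.1 = q p.2} < 1 - ENNReal.ofReal (ε ^ 2 / 4) := by
    intro n
    obtain ⟨K, i1, i2, i3, 𝓗, ξ, -, htr, hF, hno⟩ := hcon (F n) (1 / ((n : ℝ) + 1)) (by positivity)
    obtain ⟨m, h0, h1, h2, h3, h4⟩ := exists_measure_of_isTracial 𝓗 htr
    refine ⟨m, h0, h1, h2, ?_, fun i hi => ?_, ?_⟩
    · have e : ∫ p, ((J p.1 : ℝ) - J p.2) ^ 2 ∂m = ∫ p, ‖j.1 p.1 - j.1 p.2‖ ^ 2 ∂m := by
        refine integral_congr_ae (Eventually.of_forall fun p => ?_)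
        change ((J p.1 : ℝ) - J p.2) ^ 2 = ‖(((J p.1 : ℝ) : ℂ) - ((J p.2 : ℝ) : ℂ))‖ ^ 2
        rw [← Complex.ofReal_sub, Complex.norm_real, Real.norm_eq_abs, sq_abs]
      rw [e, ← h3]
      exact pow_le_pow_left₀ (norm_nonneg _) (hF _ (Finset.mem_insert_self _ _)) 2
    · refine (h4 (s i)).trans (mul_le_mul_of_nonneg_left (hF _ ?_) zero_le_two)
      exact Finset.mem_insert_of_mem (Finset.mem_image_of_mem _ (Finset.mem_range.2 hi))
    · by_contra! hge
      obtain ⟨η, hη1, hη2⟩ := exists_isCentral_of_measure_ge hq 𝓗 ξ h1 h2 h3 hε.le hge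
      exact absurd hη2 (not_le.2 (hno η hη1))
  choose σ hσ h1 h2 hJσ hdist hlt using key
  have hinv : Tendsto (fun n : ℕ => 1 / ((n : ℝ) + 1)) atTop (𝓝 0) :=
    tendsto_one_div_add_atTop_nhds_zero_nat
  have hlim : Tendsto (fun n => ∫ p, ((J p.1 : ℝ) - J p.2) ^ 2 ∂(σ n)) atTop (𝓝 0) :=
    squeeze_zero (fun n => integral_nonneg fun p => sq_nonneg _) hJσ (by simpa using hinv.pow 2)
  have hfin := hconc σ hσ (fun n => ⟨h1 n, h2 n⟩)
    (fun f₁ f₂ m₁ m₂ b₁ b₂ => tendsto_integral_mul hσ h1 ⟨f₁, m₁, b₁⟩ ⟨f₂, m₂, b₂⟩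
      (tendsto_integral_norm_sub hJ hσ h1 h2 hlim ⟨f₂, m₂, b₂⟩))
    (fun g => by
      obtain ⟨i, rfl⟩ := hs g
      refine squeeze_zero' (Eventually.of_forall fun n => measureDist_nonneg _ _) ?_
        (by simpa only [mul_zero] using hinv.const_mul 2)
      -- The unitary for `s i` is guaranteed to lie in `F n` only once `n > i`.
      filter_upwards [eventually_gt_atTop i] with n hn using hdist n i hn)
  have hle := le_of_tendsto hfin (Eventually.of_forall fun n => (hlt n).le)
  have h4 : (0 : ℝ≥0∞) < ENNReal.ofReal (ε ^ 2 / 4) := ENNReal.ofReal_pos.2 (by positivity)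
  exact absurd hle (not_le.2 (ENNReal.sub_lt_self ENNReal.one_ne_top one_ne_zero h4.ne'))
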